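/- \textbf{Theorem (spectral representation of the minimal extension).} Let $\mathcal H$ be a separable complex Hilbert space, $\Omega$ a (possibly unbounded) self-adjoint operator in $\mathcal H$, $H_1\subset\mathcal H$ a closed subspace, $H_2=H_1^\perp$, and suppose that with respect to $\mathcal H=H_1\oplus H_2$ $$\Omega=\begin{bmatrix}\Omega_1&\Gamma\\ \Gamma^\dagger&\Omega_2\end{bmatrix},\qquad \operatorname{dom}\Omega=\operatorname{dom}\Omega_1\oplus\operatorname{dom}\Omega_2,$$ where $\Omega_i$ is self-adjoint in $H_i$ and the coupling operator $\Gamma:H_2\to H_1$ is bounded. Put $\mathring\Gamma=\begin{bmatrix}0&\Gamma\\ \Gamma^\dagger&0\end{bmatrix}$, let $P_1$ be the orthogonal projection onto $H_1$, and let $dE_\lambda$ be the spectral resolution of the identity of $\Omega$. For a self-adjoint operator $A$ and a set $S$ of vectors, the orbit $\mathcal O_A(S)$ is the closed linear span of $\{f(A)v: f\in C_c(\mathbb R),\ v\in S\}$; a subspace $K$ is $A$-invariant if $\mathcal O_A(K)=K$. The open system obtained by projecting the dynamics onto $H_1$ is $(H_1,\Omega_1,a_1)$ with friction function $a_1(t)=\Gamma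 e^{-it\Omega_2}\Gamma^\dagger$, $t\ge 0$; likewise $(H_2,\Omega_2,a_2)$ with $a_2(t)=\Gamma^\dagger e^{-it\Omega_1}\Gamma$. For an open system $(G,\Omega_G,a)$ with $G$ a closed subspace of $\mathcal H$, a subspace $K$ of $\mathcal H$ (with the operator $\Omega|_K$) is called its minimal conservative extension if $K$ is $\Omega$-invariant and there are a closed subspace $G'\perp G$ with $K=G\oplus G'$, a self-adjoint $\Omega'$ in $G'$ and a bounded $\Gamma':G'\to G$ such that $\Omega|_K=\begin{bmatrix}\Omega_G&\Gamma'\\ \Gamma'^\dagger&\Omega'\end{bmatrix}$, $a(t)=\Gamma' e^{-it\Omega'}\Gamma'^\dagger$ for all $t\ge 0$, and $\mathcal O_{\Omega'}(\operatorname{Ran}\Gamma'^\dagger)=G'$. The system $(\mathcal H=H_1\oplus H_2,\Omega)$ is called reconstructible if $\mathcal H$ is the minimal conservative extension of both $(H_1,\Omega_1,a_1)$ and $(H_2,\Omega_2,a_2)$. Say that $\Omega$ has pure point spectrum if its eigenvectors span a dense subspace; an eigenmode is a (nonzero) eigenvector; for an eigenvalue $\lambda_\alpha$ let $\pi_\alpha$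 be the orthogonal projection onto its eigenspace. Then there is exactly one subspace $\mathcal H_{\min}$ of $\mathcal H$ that is the minimal conservative extension of $(H_1,\Omega_1,a_1)$, and $\mathcal H_{\min}=\mathcal O_\Omega(H_1)$. If $H_1$ contains no nonzero $\Omega$-invariant subspace, then also $\mathcal H_{\min}=\mathcal O_\Omega(\operatorname{Ran}\mathring\Gamma)$. Moreover: (i) If $\Omega$ has pure point spectrum, then $\Omega$ has at most countably many eigenvalues $\lambda_\alpha$, the subspaces $\pi_\alpha(H_1)$ are mutually orthogonal, and $\mathcal H_{\min}$ is the closure of their sum, $\mathcal H_{\min}=\bigoplus_\alpha\pi_\alpha(H_1)$. If in addition $H_1$ contains no nonzero $\Omega$-invariant subspace, the same holds with $\operatorname{Ran}\mathring\Gamma$ in place of $H_1$: $\mathcal H_{\min}=\bigoplus_\alpha\pi_\alpha(\operatorname{Ran}\mathring\Gamma)$. (ii) For arbitrary spectrum, $\mathcal H_{\min}$ is the closed linear span of the vectors $\int_\Delta dE_\lambda v$, where $v\in H_1$ and $\Delta$ is an interval of $\mathbb R$. If $H_1$ contains no nonzero $\Omega$-invariant subspace, the same holds with $v\in\operatorname{Ran}\mathring\Gamma$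 in place of $v\in H_1$. In both statements, for any $\epsilon>0$, it is enough to use those intervals $\Delta$ that lie in an interval of length $\epsilon$. (iii) If $\Omega$ has pure point spectrum, then $\mathcal H_{\min}=\mathcal H$ if and only if $P_1\phi\neq0$ for each eigenmode $\phi$ of $\Omega$. If in addition $H_1$ contains no nonzero $\Omega$-invariant subspace, then $\mathcal H_{\min}=\mathcal H$ if and only if $\mathring\Gamma\phi\neq 0$ for each eigenmode $\phi$ of $\Omega$. Finally, if $\Omega$ has pure point spectrum (with no condition on $H_1$), $(\mathcal H=H_1\oplus H_2,\Omega)$ is reconstructible if and only if $\mathring\Gamma\phi\neq0$ for each eigenmode $\phi$ of $\Omega$. -/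

import Mathlib

noncomputable section
namespace OpenSystems
open scoped InnerProductSpace CompactlySupported ComplexOrder
open MeasureTheory

section Calculus
variable {E : Type*} [NormedAddCommGroup E] [InnerProductSpace ℂ E] [CompleteSpace E]

/-- Self-adjointness (of a possibly unbounded operator) read on the graph. -/
theorem mem_graph_iff_of_isSelfAdjoint {T : E →ₗ.[ℂ] E} (hT : IsSelfAdjoint T) (x y : E) :
    (x, y) ∈ T.graph ↔ ∀ a b, (a, b) ∈ T.graph → ⟪b, x⟫_ℂ = ⟪a, y⟫_ℂ := by
  have h := LinearPMap.adjoint_graph_eq_graph_adjoint hT.dense_domain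
  rw [LinearPMap.isSelfAdjoint_def.mp hT] at h
  rw [h, Submodule.mem_adjoint_iff, ← h]
  simp only [sub_eq_zero]

theorem norm_sq_add_smul {T : E →ₗ.[ℂ] E} (hT : IsSelfAdjoint T) {x y : E}
    (h : (x, y) ∈ T.graph) (c : ℂ) (hc : c = Complex.I ∨ c = -Complex.I) :
    ‖y + c • x‖ ^ 2 = ‖y‖ ^ 2 + ‖x‖ ^ 2 := by
  have h1 := (mem_graph_iff_of_isSelfAdjoint hT x y).mp h x y h
  have h2 : (⟪y, x⟫_ℂ).im = 0 := by
    exact Complex.conj_eq_iff_im.mp (by rw [inner_conj_symm, h1])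
  have h3 := norm_add_sq (𝕜 := ℂ) y (c • x)
  rw [inner_smul_right, norm_smul] at h3
  rcases hc with rfl | rfl <;> simp [h2] at h3 <;> simp [h3]

/-- The ranges of `T + i` and `T - i` are everything. -/
theorem surjective_add_smul {T : E →ₗ.[ℂ] E} (hT : IsSelfAdjoint T)
    (c : ℂ) (hc : c = Complex.I ∨ c = -Complex.I) (z : E) :
    ∃ x y, (x, y) ∈ T.graph ∧ y + c • x = z := by
  let A : T.graph →L[ℂ] E :=
    (ContinuousLinearMap.snd ℂ E E + c • ContinuousLinearMap.fst ℂ E E).comp T.graph.subtypeL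
  have hA : ∀ p : T.graph, A p = p.1.2 + c • p.1.1 := fun p => rfl
  have hcl : IsClosed (T.graph : Set (E × E)) := hT.isClosed
  have : CompleteSpace T.graph := hcl.completeSpace_coe
  have hanti : AntilipschitzWith 1 A := by
    refine AddMonoidHomClass.antilipschitz_of_bound A (K := 1) (fun p => ?_)
    obtain ⟨⟨x, y⟩, hp⟩ := p
    have h := norm_sq_add_smul hT hp c hc
    simp only [NNReal.coe_one, one_mul]
    change max ‖x‖ ‖y‖ ≤ ‖y + c • x‖
    refine max_le ?_ ?_ <;> refine le_of_sq_le_sq ?_ (norm_nonneg _) <;>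
      nlinarith [sq_nonneg ‖x‖, sq_nonneg ‖y‖]
  have hrc : IsClosed (Set.range A) := hanti.isClosed_range A.uniformContinuous
  have hrange : A.range = ⊤ := by
    have hcl' : IsClosed (A.range : Set E) := hrc
    have : CompleteSpace A.range := hcl'.completeSpace_coe
    rw [← Submodule.orthogonal_eq_bot_iff, Submodule.eq_bot_iff]
    intro w hw
    have hw' : ∀ a b, (a, b) ∈ T.graph → ⟪b + c • a, w⟫_ℂ = 0 := fun a b hab =>
      (Submodule.mem_orthogonal _ _).mp hw _ ⟨⟨(a, b), hab⟩, rfl⟩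
    have hg : (w, c • w) ∈ T.graph := by
      rw [mem_graph_iff_of_isSelfAdjoint hT]
      intro a b hab
      have := hw' a b hab
      rw [inner_add_left, inner_smul_left] at this
      rw [inner_smul_right]
      rcases hc with rfl | rfl <;> simp at this ⊢ <;> linear_combination this
    have h1 := hw' w (c • w) hg
    rw [← two_smul ℂ, inner_smul_left, inner_smul_left] at h1
    have hc0 : c ≠ 0 := by rcases hc with rfl | rfl <;> simp
    simpa [hc0] using h1
  have hz : z ∈ A.range := hrange ▸ Submodule.mem_top
  obtain ⟨⟨⟨x, y⟩, hp⟩, rfl⟩ := hz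
  exact ⟨x, y, hp, rfl⟩

theorem exists_cayley (T : E →ₗ.[ℂ] E) (hT : IsSelfAdjoint T) :
    ∃ U : unitary (E →L[ℂ] E), ∀ x y, (x, y) ∈ T.graph →
      (U : E →L[ℂ] E) (y + Complex.I • x) = y - Complex.I • x := by
  let A : ℂ → T.graph →ₗ[ℂ] E := fun c =>
    (LinearMap.snd ℂ E E + c • LinearMap.fst ℂ E E).comp T.graph.subtype
  have hbij : ∀ c : ℂ, c = Complex.I ∨ c = -Complex.I → Function.Bijective (A c) := by
    intro c hc
    refine ⟨?_, fun z => ?_⟩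
    · rw [← LinearMap.ker_eq_bot, LinearMap.ker_eq_bot']
      rintro ⟨⟨x, y⟩, hp⟩ h0
      have h := norm_sq_add_smul hT hp c hc
      have h0' : y + c • x = 0 := h0
      rw [h0', norm_zero] at h
      have hx : ‖x‖ = 0 := by nlinarith [sq_nonneg ‖x‖, sq_nonneg ‖y‖]
      have hy : ‖y‖ = 0 := by nlinarith [sq_nonneg ‖x‖, sq_nonneg ‖y‖]
      simp only [norm_eq_zero] at hx hy
      simp [hx, hy]
    · obtain ⟨x, y, hp, h⟩ := surjective_add_smul hT c hc z
      exact ⟨⟨(x, y), hp⟩, h⟩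
  let e₁ := LinearEquiv.ofBijective (A Complex.I) (hbij _ (Or.inl rfl))
  let e₂ := LinearEquiv.ofBijective (A (-Complex.I)) (hbij _ (Or.inr rfl))
  let V : E ≃ₗᵢ[ℂ] E :=
    { e₁.symm.trans e₂ with
      norm_map' := by
        intro z
        obtain ⟨p, rfl⟩ := e₁.surjective z
        change ‖e₂ (e₁.symm (e₁ p))‖ = ‖e₁ p‖
        rw [LinearEquiv.symm_apply_apply]
        obtain ⟨⟨x, y⟩, hp⟩ := p
        change ‖y + -Complex.I • x‖ = ‖y + Complex.I • x‖
        rw [← sq_eq_sq₀ (norm_nonneg _) (norm_nonneg _),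
          norm_sq_add_smul hT hp _ (Or.inr rfl), norm_sq_add_smul hT hp _ (Or.inl rfl)] }
  refine ⟨Unitary.linearIsometryEquiv.symm V, fun x y hp => ?_⟩
  have h1 : y + Complex.I • x = e₁ ⟨(x, y), hp⟩ := rfl
  rw [h1]
  change e₂ (e₁.symm (e₁ _)) = _
  rw [LinearEquiv.symm_apply_apply]
  change y + -Complex.I • x = _
  rw [neg_smul, sub_eq_add_neg]

/-- The Cayley transform `U = (T - i) (T + i)⁻¹` of a self-adjoint operator `T`, a unitary operator.
It is determined by `cayley_spec`, since `T + i` is onto by `surjective_add_smul`. -/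
def cayley (T : E →ₗ.[ℂ] E) (hT : IsSelfAdjoint T) : unitary (E →L[ℂ] E) :=
  (exists_cayley T hT).choose

theorem cayley_spec (T : E →ₗ.[ℂ] E) (hT : IsSelfAdjoint T) {x y : E} (h : (x, y) ∈ T.graph) :
    (cayley T hT : E →L[ℂ] E) (y + Complex.I • x) = y - Complex.I • x :=
  (exists_cayley T hT).choose_spec x y h

/-- Transport of a function on `ℝ` to the unit circle along the inverse Cayley map
`z ↦ i (1 + z) / (1 - z)`, which sends `(s - i) / (s + i)` to `s`; the value at `z = 1`
(the point at infinity) is `0`. -/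
def circleFun (f : ℝ → ℂ) (z : ℂ) : ℂ :=
  if z = 1 then 0 else f (Complex.I * (1 + z) / (1 - z)).re

theorem continuousOn_circleFun (f : C_c(ℝ, ℂ)) :
    ContinuousOn (circleFun f) (Metric.sphere 0 1) := by
  intro z hz
  by_cases h1 : z = 1
  · subst h1
    obtain ⟨r, hr⟩ := f.hasCompactSupport.isCompact.isBounded.subset_closedBall 0
    have hev : ∀ᶠ w in nhdsWithin (1 : ℂ) (Metric.sphere 0 1), circleFun f w = 0 := by
      have hn : ∀ᶠ w : ℂ in nhds 1, 1 - 1 / (r ^ 2 + 1) < w.re :=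
        Complex.continuous_re.continuousAt.eventually_const_lt (by
          simp only [Complex.one_re]
          have : 0 < 1 / (r ^ 2 + 1) := by positivity
          linarith)
      filter_upwards [nhdsWithin_le_nhds hn, self_mem_nhdsWithin] with w hw hs
      by_cases hw1 : w = 1
      · simp [circleFun, hw1]
      simp only [circleFun, hw1, if_false]
      have hsq : w.re ^ 2 + w.im ^ 2 = 1 := by
        have : ‖w‖ = 1 := by simpa using hs
        rw [← Complex.normSq_add_mul_I w.re w.im, Complex.re_add_im, Complex.normSq_eq_norm_sq, this]
        norm_num
      have hre : w.re ≠ 1 := by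
        intro h
        apply hw1
        apply Complex.ext
        · simpa using h
        · have : w.im ^ 2 = 0 := by rw [h] at hsq; linarith
          simpa using this
      have hlt : w.re < 1 := lt_of_le_of_ne (by nlinarith [sq_nonneg w.im, sq_nonneg w.re]) hre
      have hval : (Complex.I * (1 + w) / (1 - w)).re = -w.im / (1 - w.re) := by
        have hd : Complex.normSq (1 - w) = 2 * (1 - w.re) := by
          rw [Complex.normSq_apply]; simp; nlinarith
        rw [Complex.div_re, hd]
        have : 1 - w.re ≠ 0 := by linarith
        simp
        field_simp
        ring
      by_contra hne
      have hm := hr (subset_tsupport _ hne)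
      rw [hval, Metric.mem_closedBall, dist_zero_right, Real.norm_eq_abs] at hm
      have hm2 : (-w.im / (1 - w.re)) ^ 2 ≤ r ^ 2 := sq_le_sq.mpr (hm.trans (le_abs_self r))
      have hd : 0 < 1 - w.re := by linarith
      rw [div_pow, div_le_iff₀ (by positivity)] at hm2
      have hb : (1 - w.re) * (r ^ 2 + 1) < 1 := by
        rw [← lt_div_iff₀ (by positivity)]; linarith
      have hfac : (-w.im) ^ 2 = (1 - w.re) * (1 + w.re) := by nlinarith
      have : 1 + w.re ≤ r ^ 2 * (1 - w.re) := by
        rw [hfac] at hm2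
        nlinarith
      nlinarith
    have h0 : circleFun f 1 = 0 := by simp [circleFun]
    rw [ContinuousWithinAt, h0]
    exact tendsto_const_nhds.congr' (hev.mono fun w hw => hw.symm)
  · have hev : circleFun f =ᶠ[nhds z] fun w => f (Complex.I * (1 + w) / (1 - w)).re := by
      filter_upwards [isOpen_ne.mem_nhds h1] with w hw
      simp [circleFun, show w ≠ 1 from hw]
    refine (ContinuousAt.congr ?_ hev.symm).continuousWithinAt
    refine f.continuous.continuousAt.comp (Complex.continuous_re.continuousAt.comp ?_)
    exact ContinuousAt.div (by fun_prop) (by fun_prop) (sub_ne_zero.mpr (Ne.symm h1))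

/-- The operator `f(T)`, for a self-adjoint `T` and a continuous compactly supported `f` on `ℝ`:
the continuous functional calculus of the unitary Cayley transform, applied to the function that
`f` induces on the unit circle. -/
def ccCalculus (T : E →ₗ.[ℂ] E) (hT : IsSelfAdjoint T) (f : ℝ → ℂ) : E →L[ℂ] E :=
  cfc (circleFun f) (cayley T hT : E →L[ℂ] E)

theorem continuousOn_spectrum (T : E →ₗ.[ℂ] E) (hT : IsSelfAdjoint T) (f : C_c(ℝ, ℂ)) :
    ContinuousOn (circleFun f) (spectrum ℂ (cayley T hT : E →L[ℂ] E)) :=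
  (continuousOn_circleFun f).mono (spectrum.subset_circle_of_unitary (cayley T hT).2)

def toComplex (f : C_c(ℝ, ℝ)) : C_c(ℝ, ℂ) := f.compLeft ⟨Complex.ofReal, Complex.continuous_ofReal⟩

@[simp] theorem toComplex_apply (f : C_c(ℝ, ℝ)) (x : ℝ) : toComplex f x = (f x : ℂ) := by
  simp [toComplex, CompactlySupportedContinuousMap.compLeft_apply]

/-- The positive functional `f ↦ ⟪v, f(T) v⟫` on real `f ∈ C_c(ℝ)`. -/
def spectralFunctional (T : E →ₗ.[ℂ] E) (hT : IsSelfAdjoint T) (v : E) : C_c(ℝ, ℝ) →ₚ[ℝ] ℝ :=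
  PositiveLinearMap.mk₀
    { toFun := fun f => (⟪v, ccCalculus T hT (toComplex f) v⟫_ℂ).re
      map_add' := fun f g => by
        have h : circleFun (toComplex (f + g)) =
            fun z => circleFun (toComplex f) z + circleFun (toComplex g) z := by
          funext z
          by_cases hz : z = 1 <;> simp [circleFun, hz]
        rw [ccCalculus, h, cfc_add _ _ _ (continuousOn_spectrum T hT _)
          (continuousOn_spectrum T hT _)]
        simp [ccCalculus]
      map_smul' := fun r f => by
        have h : circleFun (toComplex (r • f)) =
            fun z => (r : ℂ) * circleFun (toComplex f) z := by
          funext z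
          by_cases hz : z = 1 <;> simp [circleFun, hz]
        rw [ccCalculus, h, cfc_const_mul _ _ _ (continuousOn_spectrum T hT _)]
        simp [ccCalculus] }
    (fun f hf => by
      have h : 0 ≤ ccCalculus T hT (toComplex f) := by
        refine cfc_nonneg fun z _ => ?_
        by_cases hz : z = 1
        · simp [circleFun, hz]
        · simp only [circleFun, hz, if_false, toComplex_apply]
          exact_mod_cast hf _
      exact ((ContinuousLinearMap.nonneg_iff_isPositive _).mp h).re_inner_nonneg_right v)

/-- The spectral measure of `T` at the vector `v`: the Borel measure on `ℝ` with
`∫ f dμ_v = ⟪v, f(T) v⟫` for `f ∈ C_c(ℝ)`. -/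
def spectralMeasure (T : E →ₗ.[ℂ] E) (hT : IsSelfAdjoint T) (v : E) : Measure ℝ :=
  RealRMK.rieszMeasure (spectralFunctional T hT v)

theorem spectralFunctional_apply (T : E →ₗ.[ℂ] E) (hT : IsSelfAdjoint T) (v : E)
    (f : C_c(ℝ, ℝ)) :
    spectralFunctional T hT v f = (⟪v, ccCalculus T hT (toComplex f) v⟫_ℂ).re := rfl

theorem spectralMeasure_univ_le (T : E →ₗ.[ℂ] E) (hT : IsSelfAdjoint T) (v : E) :
    spectralMeasure T hT v Set.univ ≤ ENNReal.ofReal (‖v‖ ^ 2) := by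
  have : (spectralMeasure T hT v).Regular := RealRMK.regular_rieszMeasure _
  rw [isOpen_univ.measure_eq_iSup_isCompact]
  refine iSup_le fun K => iSup_le fun _ => iSup_le fun hK => ?_
  obtain ⟨f, hf1, hf2, -, hf3⟩ :=
    exists_continuousMap_one_of_isCompact_subset_isOpen hK isOpen_univ (Set.subset_univ K)
  let F : C_c(ℝ, ℝ) := ⟨f, hf2⟩
  refine (RealRMK.rieszMeasure_le_of_eq_one (f := F) _ (fun x => (hf3 x).1) hK
    (fun x hx => hf1 hx)).trans (ENNReal.ofReal_le_ofReal ?_)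
  rw [spectralFunctional_apply]
  have hn : ‖ccCalculus T hT (toComplex F)‖ ≤ 1 := by
    refine norm_cfc_le zero_le_one fun z _ => ?_
    by_cases hz : z = 1
    · simp [circleFun, hz]
    · simp only [circleFun, hz, if_false, toComplex_apply, Complex.norm_real, Real.norm_eq_abs]
      exact abs_le.mpr ⟨(neg_nonpos.mpr zero_le_one).trans (hf3 _).1, (hf3 _).2⟩
  calc (⟪v, ccCalculus T hT (toComplex F) v⟫_ℂ).re
      ≤ ‖⟪v, ccCalculus T hT (toComplex F) v⟫_ℂ‖ := Complex.re_le_norm _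
    _ ≤ ‖v‖ * ‖ccCalculus T hT (toComplex F) v‖ := norm_inner_le_norm _ _
    _ ≤ ‖v‖ * (1 * ‖v‖) := by
        gcongr
        exact (ContinuousLinearMap.le_opNorm _ _).trans (by gcongr)
    _ = ‖v‖ ^ 2 := by ring

instance (T : E →ₗ.[ℂ] E) (hT : IsSelfAdjoint T) (v : E) :
    IsFiniteMeasure (spectralMeasure T hT v) :=
  ⟨(spectralMeasure_univ_le T hT v).trans_lt ENNReal.ofReal_lt_top⟩

theorem integral_spectralMeasure (T : E →ₗ.[ℂ] E) (hT : IsSelfAdjoint T) (v : E)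
    (f : C_c(ℝ, ℝ)) : ∫ x, f x ∂(spectralMeasure T hT v) =
      (⟪v, ccCalculus T hT (toComplex f) v⟫_ℂ).re :=
  RealRMK.integral_rieszMeasure _ f

/-- A relation between quadratic forms that holds for all operators passes to spectral integrals. -/
theorem sum_integral_eq_zero (T : E →ₗ.[ℂ] E) (hT : IsSelfAdjoint T) {n : ℕ} (c : Fin n → ℝ)
    (v : Fin n → E)
    (h : ∀ A : E →L[ℂ] E, ∑ i, c i * (⟪v i, A (v i)⟫_ℂ).re = 0)
    {g : ℝ → ℂ} (hg : Measurable g) {C : ℝ} (hC : ∀ x, ‖g x‖ ≤ C) :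
    ∑ i, (c i : ℂ) * ∫ x, g x ∂(spectralMeasure T hT (v i)) = 0 := by
  let P : Measure ℝ := ∑ i, (c i).toNNReal • spectralMeasure T hT (v i)
  let N : Measure ℝ := ∑ i, (-c i).toNNReal • spectralMeasure T hT (v i)
  have hint : ∀ {F : Type} [NormedAddCommGroup F] [NormedSpace ℝ F] (d : Fin n → NNReal)
      (k : ℝ → F), (∀ i, Integrable k (spectralMeasure T hT (v i))) →
      ∫ x, k x ∂(∑ i, d i • spectralMeasure T hT (v i)) =
        ∑ i, (d i : ℝ) • ∫ x, k x ∂(spectralMeasure T hT (v i)) := by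
    intro F _ _ d k hk
    rw [integral_finsetSum_measure fun i _ => (hk i).smul_measure_nnreal]
    exact Finset.sum_congr rfl fun i _ => integral_smul_nnreal_measure _ _
  have hcoe : ∀ r : ℝ, ((r.toNNReal : ℝ) - ((-r).toNNReal : ℝ)) = r := fun r => by
    simp only [Real.coe_toNNReal']
    exact max_zero_sub_max_neg_zero_eq_self r
  have hPN : P = N := by
    refine Measure.ext_of_integral_eq_on_compactlySupported fun f => ?_
    have hk : ∀ i, Integrable (fun x => f x) (spectralMeasure T hT (v i)) := fun i => f.integrable
    rw [hint _ _ hk, hint _ _ hk, ← sub_eq_zero, ← Finset.sum_sub_distrib]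
    simp only [smul_eq_mul, ← sub_mul, hcoe, integral_spectralMeasure]
    exact h _
  have hk : ∀ i, Integrable g (spectralMeasure T hT (v i)) := fun i =>
    Integrable.of_bound hg.aestronglyMeasurable C (Filter.Eventually.of_forall hC)
  have h1 := hint (fun i => (c i).toNNReal) g hk
  have h2 := hint (fun i => (-c i).toNNReal) g hk
  have h3 : ∫ x, g x ∂P = ∫ x, g x ∂N := by rw [hPN]
  rw [h1, h2, ← sub_eq_zero, ← Finset.sum_sub_distrib] at h3
  simp only [← sub_smul, hcoe] at h3
  simpa only [Complex.real_smul] using h3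

/-- The real-bilinear form obtained from `v ↦ ∫ g dμ_v` by polarization. -/
def spectralForm (T : E →ₗ.[ℂ] E) (hT : IsSelfAdjoint T) (g : ℝ → ℂ) (u v : E) : ℂ :=
  (1 / 4 : ℝ) * ((∫ x, g x ∂(spectralMeasure T hT (u + v))) -
    ∫ x, g x ∂(spectralMeasure T hT (u - v)))

theorem spectralForm_add_right (T : E →ₗ.[ℂ] E) (hT : IsSelfAdjoint T) {g : ℝ → ℂ}
    (hg : Measurable g) {C : ℝ} (hC : ∀ x, ‖g x‖ ≤ C)
    (u v w : E) : spectralForm T hT g u (v + w) =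
    spectralForm T hT g u v + spectralForm T hT g u w := by
  have h := sum_integral_eq_zero T hT ![1 / 4, -(1 / 4), -(1 / 4), 1 / 4, -(1 / 4), 1 / 4]
    ![u + (v + w), u - (v + w), u + v, u - v, u + w, u - w]
    (fun A => by simp [Fin.sum_univ_succ]; ring) hg hC
  simp [Fin.sum_univ_succ] at h
  simp only [spectralForm]
  push_cast
  linear_combination h

theorem spectralForm_smul_right (T : E →ₗ.[ℂ] E) (hT : IsSelfAdjoint T) {g : ℝ → ℂ}
    (hg : Measurable g) {C : ℝ} (hC : ∀ x, ‖g x‖ ≤ C)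
    (u v : E) (r : ℝ) : spectralForm T hT g u ((r : ℂ) • v) =
    (r : ℂ) * spectralForm T hT g u v := by
  have h := sum_integral_eq_zero T hT ![1 / 4, -(1 / 4), -(r / 4), r / 4]
    ![u + (r : ℂ) • v, u - (r : ℂ) • v, u + v, u - v]
    (fun A => by simp [Fin.sum_univ_succ]; ring) hg hC
  simp [Fin.sum_univ_succ] at h
  simp only [spectralForm]
  push_cast
  linear_combination h

theorem spectralForm_comm (T : E →ₗ.[ℂ] E) (hT : IsSelfAdjoint T) {g : ℝ → ℂ}
    (hg : Measurable g) {C : ℝ} (hC : ∀ x, ‖g x‖ ≤ C)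
    (u v : E) : spectralForm T hT g u v = spectralForm T hT g v u := by
  have h := sum_integral_eq_zero T hT ![1 / 4, -(1 / 4), -(1 / 4), 1 / 4]
    ![u + v, u - v, v + u, v - u]
    (fun A => by simp [Fin.sum_univ_succ]; ring) hg hC
  simp [Fin.sum_univ_succ] at h
  simp only [spectralForm]
  push_cast
  linear_combination h

theorem spectralForm_I_I (T : E →ₗ.[ℂ] E) (hT : IsSelfAdjoint T) {g : ℝ → ℂ}
    (hg : Measurable g) {C : ℝ} (hC : ∀ x, ‖g x‖ ≤ C)
    (u v : E) : spectralForm T hT g (Complex.I • u) (Complex.I • v) =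
    spectralForm T hT g u v := by
  have h := sum_integral_eq_zero T hT ![1 / 4, -(1 / 4), -(1 / 4), 1 / 4]
    ![Complex.I • u + Complex.I • v, Complex.I • u - Complex.I • v, u + v, u - v]
    (fun A => by simp [Fin.sum_univ_succ]; ring) hg hC
  simp [Fin.sum_univ_succ] at h
  simp only [spectralForm]
  push_cast
  linear_combination h

theorem spectralForm_I_self (T : E →ₗ.[ℂ] E) (hT : IsSelfAdjoint T) {g : ℝ → ℂ}
    (hg : Measurable g) {C : ℝ} (hC : ∀ x, ‖g x‖ ≤ C)
    (v : E) : spectralForm T hT g v (Complex.I • v) = 0 := by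
  have h := sum_integral_eq_zero T hT ![1 / 4, -(1 / 4)]
    ![v + Complex.I • v, v - Complex.I • v]
    (fun A => by simp [Fin.sum_univ_succ]; ring) hg hC
  simp [Fin.sum_univ_succ] at h
  simp only [spectralForm]
  push_cast
  linear_combination h

theorem spectralForm_self (T : E →ₗ.[ℂ] E) (hT : IsSelfAdjoint T) {g : ℝ → ℂ}
    (hg : Measurable g) {C : ℝ} (hC : ∀ x, ‖g x‖ ≤ C)
    (v : E) :
    spectralForm T hT g v v = ∫ x, g x ∂(spectralMeasure T hT v) := by
  have h := sum_integral_eq_zero T hT ![1 / 4, -(1 / 4), -1]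
    ![v + v, v - v, v]
    (fun A => by simp [Fin.sum_univ_succ]; ring) hg hC
  simp [Fin.sum_univ_succ] at h
  simp only [spectralForm, sub_self]
  push_cast
  linear_combination h

theorem norm_spectralForm_le (T : E →ₗ.[ℂ] E) (hT : IsSelfAdjoint T) {g : ℝ → ℂ}
    (hg : Measurable g) {C : ℝ} (hC : ∀ x, ‖g x‖ ≤ C)
    (u v : E) : ‖spectralForm T hT g u v‖ ≤ C * ‖u‖ * ‖v‖ := by
  have hC0 : 0 ≤ C := (norm_nonneg _).trans (hC 0)
  have hQ : ∀ w : E, ‖∫ x, g x ∂(spectralMeasure T hT w)‖ ≤ C * ‖w‖ ^ 2 := by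
    intro w
    refine (norm_integral_le_of_norm_le_const (Filter.Eventually.of_forall hC)).trans ?_
    gcongr
    exact ENNReal.toReal_le_of_le_ofReal (by positivity) (spectralMeasure_univ_le T hT w)
  have h1 : ∀ u v : E, ‖spectralForm T hT g u v‖ ≤ C * ((‖u‖ ^ 2 + ‖v‖ ^ 2) / 2) := by
    intro u v
    have hp := parallelogram_law_with_norm ℂ u v
    rw [spectralForm, norm_mul]
    have h4 : ‖((1 / 4 : ℝ) : ℂ)‖ = 1 / 4 := by
      rw [Complex.norm_real, Real.norm_of_nonneg (by norm_num)]
    rw [h4]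
    have := (norm_sub_le (∫ x, g x ∂(spectralMeasure T hT (u + v)))
      (∫ x, g x ∂(spectralMeasure T hT (u - v)))).trans (add_le_add (hQ _) (hQ _))
    calc _ ≤ 1 / 4 * (C * ‖u + v‖ ^ 2 + C * ‖u - v‖ ^ 2) := by gcongr
      _ = C * ((‖u + v‖ ^ 2 + ‖u - v‖ ^ 2) / 4) := by ring
      _ = C * ((‖u‖ ^ 2 + ‖v‖ ^ 2) / 2) := by rw [hp]; ring
  by_cases hu : u = 0
  · have := spectralForm_smul_right T hT hg hC v 0 0
    rw [hu, spectralForm_comm T hT hg hC]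
    simp at this
    simp [this]
  by_cases hv : v = 0
  · have := spectralForm_smul_right T hT hg hC u 0 0
    rw [hv]
    simp at this
    simp [this]
  have hu' : 0 < ‖u‖ := norm_pos_iff.mpr hu
  have hv' : 0 < ‖v‖ := norm_pos_iff.mpr hv
  have h2 := h1 (((‖u‖⁻¹ : ℝ) : ℂ) • u) (((‖v‖⁻¹ : ℝ) : ℂ) • v)
  rw [spectralForm_smul_right T hT hg hC, spectralForm_comm T hT hg hC,
    spectralForm_smul_right T hT hg hC, spectralForm_comm T hT hg hC, norm_smul, norm_smul,
    norm_mul, norm_mul, Complex.norm_real, Complex.norm_real, norm_inv, norm_inv, norm_norm,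
    norm_norm, inv_mul_cancel₀ hu'.ne', inv_mul_cancel₀ hv'.ne'] at h2
  have h3 : ‖v‖⁻¹ * (‖u‖⁻¹ * ‖spectralForm T hT g u v‖) =
      ‖spectralForm T hT g u v‖ / (‖u‖ * ‖v‖) := by field_simp
  rw [h3, div_le_iff₀ (by positivity)] at h2
  linarith

theorem exists_borelCalculus (T : E →ₗ.[ℂ] E) (hT : IsSelfAdjoint T) {g : ℝ → ℂ}
    (hg : Measurable g) {C : ℝ} (hC : ∀ x, ‖g x‖ ≤ C) : ∃ A : E →L[ℂ] E, ∀ v,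
    ⟪v, A v⟫_ℂ = ∫ x, g x ∂(spectralMeasure T hT v) := by
  have hadd := spectralForm_add_right T hT hg hC
  have hsmul := spectralForm_smul_right T hT hg hC
  have hcomm := spectralForm_comm T hT hg hC
  have hII := spectralForm_I_I T hT hg hC
  have hneg : ∀ u v, spectralForm T hT g u (-v) = -spectralForm T hT g u v := fun u v => by
    have := hsmul u v (-1)
    simpa using this
  have hI : ∀ u v, spectralForm T hT g (Complex.I • u) v =
      -spectralForm T hT g u (Complex.I • v) := fun u v => by
    rw [← hII, smul_smul, Complex.I_mul_I, neg_one_smul, hcomm, hneg, hcomm]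
  have hIr : ∀ u v, spectralForm T hT g u (Complex.I • Complex.I • v) =
      -spectralForm T hT g u v := fun u v => by
    rw [smul_smul, Complex.I_mul_I, neg_one_smul, hneg]
  have hc : ∀ (c : ℂ) (v : E), c • v = (c.re : ℂ) • v + (c.im : ℂ) • (Complex.I • v) := by
    intro c v
    rw [smul_smul, ← add_smul, Complex.re_add_im]
  have hsmulc : ∀ (c : ℂ) u v, spectralForm T hT g u (c • v) =
      c.re * spectralForm T hT g u v + c.im * spectralForm T hT g u (Complex.I • v) := by
    intro c u v
    rw [hc, hadd, hsmul, hsmul]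
  have hsmull : ∀ (c : ℂ) u v, spectralForm T hT g (c • u) v =
      c.re * spectralForm T hT g u v + c.im * spectralForm T hT g (Complex.I • u) v := by
    intro c u v
    rw [hcomm, hsmulc, hcomm u, hcomm (Complex.I • u)]
  let B : E →ₗ⋆[ℂ] E →ₗ[ℂ] ℂ := LinearMap.mk₂'ₛₗ (starRingEnd ℂ) (RingHom.id ℂ)
    (fun u v => spectralForm T hT g u v - Complex.I * spectralForm T hT g u (Complex.I • v))
    (fun u u' v => by
      rw [hcomm (u + u'), hcomm (u + u'), hadd, hadd, hcomm v, hcomm v, hcomm (Complex.I • v),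
        hcomm (Complex.I • v)]
      ring)
    (fun c u v => by
      rw [hsmull c u v, hsmull c u (Complex.I • v), hI, hI, hIr]
      rw [show (starRingEnd ℂ) c = c.re - c.im * Complex.I from Complex.ext (by simp) (by simp)]
      simp only [smul_eq_mul]
      linear_combination (-c.im) * spectralForm T hT g u (Complex.I • v) * Complex.I_mul_I)
    (fun u v v' => by
      rw [smul_add, hadd, hadd]
      ring)
    (fun c u v => by
      rw [smul_comm Complex.I c v, hsmulc, hsmulc c u (Complex.I • v), hIr]
      conv_rhs => rw [← Complex.re_add_im c]
      simp only [RingHom.id_apply, smul_eq_mul]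
      linear_combination c.im * spectralForm T hT g u (Complex.I • v) * Complex.I_mul_I)
  let B' := B.mkContinuous₂ (2 * C) (fun u v => by
    change ‖spectralForm T hT g u v - Complex.I * spectralForm T hT g u (Complex.I • v)‖ ≤ _
    refine (norm_sub_le _ _).trans ?_
    rw [norm_mul, Complex.norm_I, one_mul]
    have h1 := norm_spectralForm_le T hT hg hC u v
    have h2 := norm_spectralForm_le T hT hg hC u (Complex.I • v)
    rw [norm_smul, Complex.norm_I, one_mul] at h2
    linarith)
  refine ⟨ContinuousLinearMap.adjoint (InnerProductSpace.continuousLinearMapOfBilin B'),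
    fun v => ?_⟩
  rw [ContinuousLinearMap.adjoint_inner_right,
    InnerProductSpace.continuousLinearMapOfBilin_apply]
  change spectralForm T hT g v v - Complex.I * spectralForm T hT g v (Complex.I • v) = _
  rw [spectralForm_I_self T hT hg hC, spectralForm_self T hT hg hC, mul_zero, sub_zero]


variable (T : E →ₗ.[ℂ] E) (hT : IsSelfAdjoint T)

open Classical in
/-- The operator `g(T)` for a bounded Borel function `g` on `ℝ`: the bounded operator with
`⟪v, g(T) v⟫ = ∫ g dμ_v` for all `v`. It exists by `exists_borelCalculus` and is unique because a
complex Hilbert space operator is determined by its quadratic form. -/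
def borelCalculus (g : ℝ → ℂ) : E →L[ℂ] E :=
  if h : ∃ A : E →L[ℂ] E, ∀ v, ⟪v, A v⟫_ℂ = ∫ x, g x ∂(spectralMeasure T hT v) then h.choose else 0

theorem inner_borelCalculus {g : ℝ → ℂ} (hg : Measurable g) {C : ℝ} (hC : ∀ x, ‖g x‖ ≤ C) (v : E) :
    ⟪v, borelCalculus T hT g v⟫_ℂ = ∫ x, g x ∂(spectralMeasure T hT v) := by
  have h := exists_borelCalculus T hT hg hC
  rw [borelCalculus, dif_pos h]
  exact h.choose_spec v

/-- The spectral projection `E(B) = ∫_B dE_s` of `T`, for a Borel set `B ⊆ ℝ`. -/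
def spectralProjection (B : Set ℝ) : E →L[ℂ] E := borelCalculus T hT (B.indicator fun _ => 1)

/-- The unitary group `exp(-i t T)`. -/
def evolution (t : ℝ) : E →L[ℂ] E :=
  borelCalculus T hT fun s => Complex.exp (-(Complex.I * t * s))

/-- The closed orbit `O_T(S)`: the closed span of `f(T) v`, `f ∈ C_c(ℝ)`, `v ∈ S`. -/
def orbit (S : Set E) : Submodule ℂ E :=
  (Submodule.span ℂ {w | ∃ f : C_c(ℝ, ℂ), ∃ v ∈ S, w = ccCalculus T hT f v}).topologicalClosure

/-- `K` is invariant with respect to `T` if `O_T(K) = K` (so `K` is closed). -/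
def IsInvariant (K : Submodule ℂ E) : Prop := orbit T hT K = K

/-- The closed span of the vectors `E(Δ) v` with `v ∈ S` and `Δ` in the family `D` of sets. -/
def spectralSpan (D : Set (Set ℝ)) (S : Set E) : Submodule ℂ E :=
  (Submodule.span ℂ
    {w | ∃ Δ ∈ D, ∃ v ∈ S, w = spectralProjection T hT Δ v}).topologicalClosure

/-- The eigenspace `{v ∈ dom T | T v = z v}`. -/
def eigenspace (z : ℂ) : Submodule ℂ E :=
  T.graph.comap (LinearMap.prod LinearMap.id (z • LinearMap.id))

/-- The set of eigenvalues of `T`. -/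
def eigenvalues : Set ℂ := {z | eigenspace T z ≠ ⊥}

/-- `φ` is an eigenmode of `T`, that is, an eigenvector (nonzero by definition). -/
def IsEigenmode (φ : E) : Prop := φ ≠ 0 ∧ ∃ z : ℂ, φ ∈ eigenspace T z

/-- `T` has pure point spectrum: its eigenvectors span a dense subspace. -/
def HasPurePointSpectrum : Prop := (⨆ z : ℂ, eigenspace T z).topologicalClosure = ⊤

theorem isClosed_eigenspace {T : E →ₗ.[ℂ] E} (hT : IsSelfAdjoint T) (z : ℂ) :
    IsClosed (eigenspace T z : Set E) := by
  have hcl : IsClosed (T.graph : Set (E × E)) := hT.isClosed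
  exact hcl.preimage (continuous_id.prodMk (continuous_id.const_smul z))

/-- The orthogonal projection of `E` onto the eigenspace of `T` for `z`. -/
def eigenProjection (z : ℂ) : E →L[ℂ] E :=
  have : CompleteSpace (eigenspace T z) := (isClosed_eigenspace hT z).completeSpace_coe
  (eigenspace T z).starProjection

/-- The projection of the subspace `S` onto the eigenspace for `z`. -/
def projectedEigenspace (S : Submodule ℂ E) (z : ℂ) : Submodule ℂ E :=
  S.map (eigenProjection T hT z).toLinearMap

/-- `K` is the closed orthogonal sum of the family `V`. -/
def IsClosedOrthogonalSum {ι : Type*} (K : Submodule ℂ E) (V : ι → Submodule ℂ E) : Prop :=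
  (∀ i j, i ≠ j → V i ⟂ V j) ∧ K = (⨆ i, V i).topologicalClosure

end Calculus

/-- The intervals of `ℝ`, of any kind. -/
def intervals : Set (Set ℝ) := {Δ | Δ.OrdConnected}

/-- The intervals of `ℝ` that are contained in an interval of length `ε`. -/
def intervalsOfLength (ε : ℝ) : Set (Set ℝ) :=
  {Δ | Δ.OrdConnected ∧ ∃ c : ℝ, Δ ⊆ Set.Icc c (c + ε)}

section Systems

/-- The friction function `a(t) = Γ exp(-i t Ω₂) Γ†` of the open system that is obtained by
projecting the conservative system with coupling `Γ : H₂ → H₁` and hidden dynamics `Ω₂` to `H₁`. -/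
def frictionFunction {H₁ H₂ : Type*} [NormedAddCommGroup H₁] [InnerProductSpace ℂ H₁]
    [CompleteSpace H₁] [NormedAddCommGroup H₂] [InnerProductSpace ℂ H₂] [CompleteSpace H₂]
    (Ω₂ : H₂ →ₗ.[ℂ] H₂) (hΩ₂ : IsSelfAdjoint Ω₂) (Γ : H₂ →L[ℂ] H₁) (t : ℝ) : H₁ →L[ℂ] H₁ :=
  Γ ∘L evolution Ω₂ hΩ₂ t ∘L ContinuousLinearMap.adjoint Γ

/-- `(H₂, Ω₂, Γ)` is a minimal triple for the friction function `a` on `H₁`: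
`a(t) = Γ exp(-i t Ω₂) Γ†` for `t ≥ 0`, and the span of `f(Ω₂) Γ† v`, `f ∈ C_c(ℝ)`, `v ∈ H₁`,
is dense in `H₂`. -/
structure IsMinimalTriple {H₁ H₂ : Type*} [NormedAddCommGroup H₁] [InnerProductSpace ℂ H₁]
    [CompleteSpace H₁] [NormedAddCommGroup H₂] [InnerProductSpace ℂ H₂] [CompleteSpace H₂]
    (a : ℝ → H₁ →L[ℂ] H₁) (Ω₂ : H₂ →ₗ.[ℂ] H₂) (hΩ₂ : IsSelfAdjoint Ω₂) (Γ : H₂ →L[ℂ] H₁) :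
    Prop where
  friction : ∀ t, 0 ≤ t → a t = frictionFunction Ω₂ hΩ₂ Γ t
  minimal : orbit Ω₂ hΩ₂ (Set.range (ContinuousLinearMap.adjoint Γ)) = ⊤

variable {H : Type*} [NormedAddCommGroup H] [InnerProductSpace ℂ H] [CompleteSpace H]

/-- The restriction of the operator `T` to the subspace `K` (with domain `K ∩ dom T`) is the block
operator `[[TA, G], [G†, TB]]` with respect to `A ⊕ B`, on its natural domain `dom TA ⊕ dom TB`. -/
def HasBlockForm (T : H →ₗ.[ℂ] H) (K A B : Submodule ℂ H) [CompleteSpace A] [CompleteSpace B]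
    (TA : A →ₗ.[ℂ] A) (TB : B →ₗ.[ℂ] B) (G : B →L[ℂ] A) : Prop :=
  ∀ x y : H, (x ∈ K ∧ (x, y) ∈ T.graph) ↔
    ∃ (a : TA.domain) (b : TB.domain), x = ((a : A) : H) + ((b : B) : H) ∧
      y = ((TA a + G b : A) : H) + ((ContinuousLinearMap.adjoint G a + TB b : B) : H)

/-- The subsystem `(K, Ω restricted to K)` of the conservative system `(H, Ω)` is the minimal
conservative extension of the open system `(H₁, Ω₁, a)`, for the subspace `H₁` of `H`: `K` is
`Ω`-invariant, and `K = H₁ ⊕ H₂'` is an orthogonal sum with respect to which `Ω` restricted to `K`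
is the block operator `[[Ω₁, Γ'], [Γ'†, Ω₂']]` where `(H₂', Ω₂', Γ')` is a minimal triple
for `a`. -/
def IsMinimalExtensionIn (Ω : H →ₗ.[ℂ] H) (hΩ : IsSelfAdjoint Ω) (H₁ : Submodule ℂ H)
    [CompleteSpace H₁] (Ω₁ : H₁ →ₗ.[ℂ] H₁) (a : ℝ → H₁ →L[ℂ] H₁) (K : Submodule ℂ H) : Prop :=
  IsInvariant Ω hΩ K ∧
  ∃ (H₂' : Submodule ℂ H) (_ : CompleteSpace H₂') (Ω₂' : H₂' →ₗ.[ℂ] H₂')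
    (hΩ₂' : IsSelfAdjoint Ω₂') (Γ' : H₂' →L[ℂ] H₁),
    H₂' ≤ H₁ᗮ ∧ K = H₁ ⊔ H₂' ∧ HasBlockForm Ω K H₁ H₂' Ω₁ Ω₂' Γ' ∧
      IsMinimalTriple a Ω₂' hΩ₂' Γ'

/-- The conservative system `(H = H₁ ⊕ H₂, Ω)` is reconstructible: it is the minimal conservative
extension of each of the two open systems `(H₁, Ω₁, Γ exp(-i t Ω₂) Γ†)` and
`(H₂, Ω₂, Γ† exp(-i t Ω₁) Γ)`. -/
def IsReconstructible (Ω : H →ₗ.[ℂ] H) (hΩ : IsSelfAdjoint Ω) (H₁ : Submodule ℂ H)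
    [CompleteSpace H₁] (Ω₁ : H₁ →ₗ.[ℂ] H₁) (hΩ₁ : IsSelfAdjoint Ω₁)
    (Ω₂ : H₁ᗮ →ₗ.[ℂ] H₁ᗮ) (hΩ₂ : IsSelfAdjoint Ω₂) (Γ : H₁ᗮ →L[ℂ] H₁) : Prop :=
  IsMinimalExtensionIn Ω hΩ H₁ Ω₁ (frictionFunction Ω₂ hΩ₂ Γ) ⊤ ∧
  IsMinimalExtensionIn Ω hΩ H₁ᗮ Ω₂
    (frictionFunction Ω₁ hΩ₁ (ContinuousLinearMap.adjoint Γ)) ⊤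

/-- The off-diagonal coupling operator `[[0, Γ], [Γ†, 0]]` on `H = H₁ ⊕ H₁ᗮ`. -/
def couplingOperator (H₁ : Submodule ℂ H) [CompleteSpace H₁] (Γ : H₁ᗮ →L[ℂ] H₁) : H →L[ℂ] H :=
  H₁.subtypeL ∘L Γ ∘L H₁ᗮ.orthogonalProjectionOnto +
    H₁ᗮ.subtypeL ∘L ContinuousLinearMap.adjoint Γ ∘L H₁.orthogonalProjectionOnto

/-- `H₁` contains no nontrivial (that is, nonzero) `Ω`-invariant subspace. -/
def HasNoInvariantSubspace (Ω : H →ₗ.[ℂ] H) (hΩ : IsSelfAdjoint Ω) (H₁ : Submodule ℂ H) : Prop :=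
  ∀ K : Submodule ℂ H, K ≤ H₁ → IsInvariant Ω hΩ K → K = ⊥

end Systems
end OpenSystems
end

open OpenSystems

namespace OpenSystems
open scoped InnerProductSpace CompactlySupported ComplexOrder
open MeasureTheory

/-! ### Functional calculus under intertwining operators -/

section Intertwining

variable {E F : Type*} [NormedAddCommGroup E] [InnerProductSpace ℂ E] [CompleteSpace E]
  [NormedAddCommGroup F] [InnerProductSpace ℂ F] [CompleteSpace F]

/-! The unbounded operator is replaced by its Cayley transform `U`, a unitary that encodes the whole
graph (`cayley_apply_eq_iff`). Whatever respects graphs commutes with `U`, hence with every `f(T)`.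
Invariant subspaces are then exactly the closed subspaces stable under `U` and `U*`
(`isInvariant_iff_reduces`), and the orbit of `S` is the smallest one containing `S`. The analytic
point is `subset_orbit`: functions in `C_c(ℝ)` miss only the point at infinity, `z = 1` on the
circle, and `U` has no eigenvalue `1`.

For the block operator, let `L` be the `Ω₂`-orbit of `Ran Γ†`. Compressing everything to `H₁ ⊕ L`
loses nothing: `H₁ ⊕ L` reduces `Ω`, `Γ` vanishes on the complement of `L` in `H₂`, and the friction
function is unchanged. This subspace equals the orbit of `H₁` and is a minimal extension
(`HasBlockForm.orbit_eq_sup`, `HasBlockForm.isMinimalExtensionIn_orbit`). Conversely, a reducing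
subspace that contains `H₁` must contain `Ran Γ†` and its orbit, which makes the extension unique
(`IsMinimalExtensionIn.eq_orbit`).

To pass from `H₁` to the range of the coupling, consider the part of the orbit of `H₁` orthogonal to
the orbit of that range. The coupling annihilates it, so there `Ω` commutes with `P₁`; its
projection to `H₁` has an invariant closure inside `H₁`, which must be zero. Hence it is orthogonal
to `H₁`, thus to the orbit of `H₁`, and vanishes (`HasBlockForm.orbit_range_couplingOperator`).

The descriptions by spectral projections and by eigenspaces hold for the orbit of any subspace:
`orbit_eq_spectralSpan` uses polarization and uniqueness of measures,
`orbit_eq_closure_iSup_projectedEigenspace` the density of eigenvectors. With pure point spectrum an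
orbit is everything exactly when no eigenmode is orthogonal to the generating subspace
(`orbit_eq_top_iff`). Applied to `H₁` and `H₂`, this turns reconstructibility into the absence of
eigenmodes inside either summand, which is the coupling criterion. -/

theorem cayley_apply_eq_iff (T : E →ₗ.[ℂ] E) (hT : IsSelfAdjoint T) (x y : E) :
    (cayley T hT : E →L[ℂ] E) (y + Complex.I • x) = y - Complex.I • x ↔ (x, y) ∈ T.graph := by
  refine ⟨fun h => ?_, cayley_spec T hT⟩
  obtain ⟨x', y', hp, hz⟩ := surjective_add_smul hT Complex.I (Or.inl rfl) (y + Complex.I • x)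
  have h' := cayley_spec T hT hp
  rw [hz, h] at h'
  have hy : y = y' := by
    have : (2 : ℂ) • y = (2 : ℂ) • y' := by
      rw [two_smul, two_smul]
      linear_combination (norm := module) h' - hz
    exact smul_right_injective E (two_ne_zero (α := ℂ)) this
  have hx : x = x' := by
    subst hy
    exact (smul_right_injective E Complex.I_ne_zero (add_left_cancel hz)).symm
  rwa [hx, hy]

/-- A fixed vector `u` would put `(0, u)` in the graph, and a graph is single-valued. This says that
the point at infinity carries no spectral mass. -/
theorem eq_zero_of_cayley_apply_eq_self {T : E →ₗ.[ℂ] E} {hT : IsSelfAdjoint T} {u : E}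
    (h : (cayley T hT : E →L[ℂ] E) u = u) : u = 0 := by
  have : ((0 : E), u) ∈ T.graph := by
    rw [← cayley_apply_eq_iff T hT]
    simpa using h
  exact T.graph_fst_eq_zero_snd this rfl

theorem intertwines_cayley {T : E →ₗ.[ℂ] E} (hT : IsSelfAdjoint T) {S : F →ₗ.[ℂ] F}
    (hS : IsSelfAdjoint S) {J : F →L[ℂ] E}
    (h : ∀ x y, (x, y) ∈ S.graph → (J x, J y) ∈ T.graph) :
    J ∘L (cayley S hS : F →L[ℂ] F) = (cayley T hT : E →L[ℂ] E) ∘L J := by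
  ext z
  obtain ⟨x, y, hp, rfl⟩ := surjective_add_smul hS Complex.I (Or.inl rfl) z
  have h1 := cayley_spec T hT (h x y hp)
  simp only [ContinuousLinearMap.comp_apply]
  rw [cayley_spec S hS hp, map_add, map_sub, map_smul, h1]

theorem unitary_apply_star_apply (V : unitary (E →L[ℂ] E)) (x : E) :
    (V : E →L[ℂ] E) (star (V : E →L[ℂ] E) x) = x :=
  congrArg (fun A : E →L[ℂ] E => A x) (Unitary.mul_star_self_of_mem V.2)

theorem unitary_star_apply_apply (V : unitary (E →L[ℂ] E)) (x : E) :
    star (V : E →L[ℂ] E) ((V : E →L[ℂ] E) x) = x :=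
  congrArg (fun A : E →L[ℂ] E => A x) (Unitary.star_mul_self_of_mem V.2)

theorem intertwines_star {V : unitary (E →L[ℂ] E)} {W : unitary (F →L[ℂ] F)} {J : F →L[ℂ] E}
    (h : J ∘L (W : F →L[ℂ] F) = (V : E →L[ℂ] E) ∘L J) :
    J ∘L star (W : F →L[ℂ] F) = star (V : E →L[ℂ] E) ∘L J := by
  ext x
  have h1 := congrArg (fun A : F →L[ℂ] E => A (star (W : F →L[ℂ] F) x)) h
  simp only [ContinuousLinearMap.comp_apply, unitary_apply_star_apply] at h1
  simp only [ContinuousLinearMap.comp_apply]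
  rw [h1, unitary_star_apply_apply]

/-- The continuous functional calculus of a unitary, on functions on the unit circle. -/
noncomputable def circleCalculus (V : unitary (E →L[ℂ] E)) :
    C(Metric.sphere (0 : ℂ) 1, ℂ) →⋆ₐ[ℂ] (E →L[ℂ] E) :=
  (cfcHom (R := ℂ) (a := (V : E →L[ℂ] E)) (p := IsStarNormal) inferInstance).comp
    (ContinuousMap.compStarAlgHom' ℂ ℂ
      ⟨Set.inclusion (spectrum.subset_circle_of_unitary V.2), continuous_inclusion _⟩)

theorem continuous_circleCalculus (V : unitary (E →L[ℂ] E)) : Continuous (circleCalculus V) :=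
  (cfcHom_continuous _).comp (ContinuousMap.continuous_precomp _)

theorem cfc_eq_circleCalculus (V : unitary (E →L[ℂ] E)) {f : ℂ → ℂ}
    (hf : ContinuousOn f (Metric.sphere 0 1)) :
    cfc f (V : E →L[ℂ] E) = circleCalculus V ⟨_, hf.domRestrict⟩ := by
  rw [cfc_apply f (V : E →L[ℂ] E) (p := IsStarNormal) inferInstance
    (hf.mono (spectrum.subset_circle_of_unitary V.2))]
  rfl

theorem circleCalculus_id (V : unitary (E →L[ℂ] E)) :
    circleCalculus V (.restrict _ (.id ℂ)) = V :=
  cfcHom_id _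

/-- Stone–Weierstrass: the functions for which this holds form a closed set, stable under sums and
products, that contains the constants, `z` and its conjugate. Functions live on the circle, not on a
spectrum, so that the same `f` serves both unitaries. -/
theorem intertwines_circleCalculus {V : unitary (E →L[ℂ] E)} {W : unitary (F →L[ℂ] F)}
    {J : F →L[ℂ] E} (h : J ∘L (W : F →L[ℂ] F) = (V : E →L[ℂ] E) ∘L J)
    (f : C(Metric.sphere (0 : ℂ) 1, ℂ)) :
    J ∘L circleCalculus W f = circleCalculus V f ∘L J := by
  induction f using ContinuousMap.induction_on_of_compact with
  | const r =>
    have hr : ContinuousMap.const (Metric.sphere (0 : ℂ) 1) r = algebraMap ℂ _ r := rfl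
    rw [hr, AlgHomClass.commutes, AlgHomClass.commutes]
    ext x
    simp [Algebra.algebraMap_eq_smul_one]
  | id => rwa [circleCalculus_id, circleCalculus_id]
  | star_id =>
    rw [map_star, map_star, circleCalculus_id, circleCalculus_id]
    exact intertwines_star h
  | add f g hf hg => rw [map_add, map_add, ContinuousLinearMap.comp_add, hf, hg,
      ContinuousLinearMap.add_comp]
  | mul f g hf hg =>
    rw [map_mul, map_mul]
    change (J ∘L circleCalculus W f) ∘L circleCalculus W g =
      circleCalculus V f ∘L (circleCalculus V g ∘L J)
    rw [hf, ← hg]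
    rfl
  | frequently f hf =>
    refine hf.mem_of_closed (isClosed_eq ?_ ?_)
    · exact ((ContinuousLinearMap.compL ℂ F F E) J).continuous.comp (continuous_circleCalculus W)
    · exact ((ContinuousLinearMap.compL ℂ F E E).flip J).continuous.comp
        (continuous_circleCalculus V)

theorem intertwines_ccCalculus {T : E →ₗ.[ℂ] E} (hT : IsSelfAdjoint T) {S : F →ₗ.[ℂ] F}
    (hS : IsSelfAdjoint S) {J : F →L[ℂ] E}
    (h : J ∘L (cayley S hS : F →L[ℂ] F) = (cayley T hT : E →L[ℂ] E) ∘L J) (f : C_c(ℝ, ℂ)) :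
    J ∘L ccCalculus S hS f = ccCalculus T hT f ∘L J := by
  rw [ccCalculus, ccCalculus, cfc_eq_circleCalculus _ (continuousOn_circleFun f),
    cfc_eq_circleCalculus _ (continuousOn_circleFun f)]
  exact intertwines_circleCalculus h _

theorem spectralMeasure_congr {T : E →ₗ.[ℂ] E} (hT : IsSelfAdjoint T) {S : F →ₗ.[ℂ] F}
    (hS : IsSelfAdjoint S) {v : E} {w : F}
    (h : ∀ f : C_c(ℝ, ℂ), ⟪v, ccCalculus T hT f v⟫_ℂ = ⟪w, ccCalculus S hS f w⟫_ℂ) :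
    spectralMeasure T hT v = spectralMeasure S hS w :=
  Measure.ext_of_integral_eq_on_compactlySupported fun f => by
    rw [integral_spectralMeasure, integral_spectralMeasure, h]

theorem spectralMeasure_map {T : E →ₗ.[ℂ] E} (hT : IsSelfAdjoint T) {S : F →ₗ.[ℂ] F}
    (hS : IsSelfAdjoint S) {J : F →L[ℂ] E} (hJ : ContinuousLinearMap.adjoint J ∘L J = .id ℂ F)
    (h : J ∘L (cayley S hS : F →L[ℂ] F) = (cayley T hT : E →L[ℂ] E) ∘L J) (v : F) :
    spectralMeasure T hT (J v) = spectralMeasure S hS v :=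
  spectralMeasure_congr hT hS fun f => by
    have h1 : J (ccCalculus S hS f v) = ccCalculus T hT f (J v) :=
      congrArg (fun A : F →L[ℂ] E => A v) (intertwines_ccCalculus hT hS h f)
    have h2 : ∀ x, ContinuousLinearMap.adjoint J (J x) = x := fun x =>
      congrArg (fun A : F →L[ℂ] F => A x) hJ
    rw [← h1, ← ContinuousLinearMap.adjoint_inner_right, h2]

/-- Spectral measures are preserved by the isometry, so both sides have the same quadratic form.
This suffices for the friction function, which sees the evolution only through such a compression.
-/
theorem borelCalculus_compression {T : E →ₗ.[ℂ] E} (hT : IsSelfAdjoint T) {S : F →ₗ.[ℂ] F}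
    (hS : IsSelfAdjoint S) {J : F →L[ℂ] E} (hJ : ContinuousLinearMap.adjoint J ∘L J = .id ℂ F)
    (h : J ∘L (cayley S hS : F →L[ℂ] F) = (cayley T hT : E →L[ℂ] E) ∘L J)
    {g : ℝ → ℂ} (hg : Measurable g) {C : ℝ} (hC : ∀ x, ‖g x‖ ≤ C) :
    ContinuousLinearMap.adjoint J ∘L borelCalculus T hT g ∘L J = borelCalculus S hS g := by
  refine ContinuousLinearMap.coe_injective ((ext_inner_map _ _).mp fun x => ?_)
  -- Conjugation moves the operator to the second slot, where the Borel calculus is characterized.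
  refine (starRingEnd ℂ).injective ?_
  rw [inner_conj_symm, inner_conj_symm]
  change ⟪x, ContinuousLinearMap.adjoint J (borelCalculus T hT g (J x))⟫_ℂ =
    ⟪x, borelCalculus S hS g x⟫_ℂ
  rw [ContinuousLinearMap.adjoint_inner_right, inner_borelCalculus T hT hg hC,
    inner_borelCalculus S hS hg hC, spectralMeasure_map hT hS hJ h]

theorem evolution_compression {T : E →ₗ.[ℂ] E} (hT : IsSelfAdjoint T) {S : F →ₗ.[ℂ] F}
    (hS : IsSelfAdjoint S) {J : F →L[ℂ] E} (hJ : ContinuousLinearMap.adjoint J ∘L J = .id ℂ F)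
    (h : J ∘L (cayley S hS : F →L[ℂ] F) = (cayley T hT : E →L[ℂ] E) ∘L J) (t : ℝ) :
    ContinuousLinearMap.adjoint J ∘L evolution T hT t ∘L J = evolution S hS t := by
  refine borelCalculus_compression hT hS hJ h (C := 1) (by fun_prop) fun s => ?_
  rw [show -(Complex.I * t * s) = ((-(t * s) : ℝ) : ℂ) * Complex.I by push_cast; ring,
    Complex.norm_exp_ofReal_mul_I]

end Intertwining

/-! ### Reducing subspaces and orbits -/

section Reducing

variable {E : Type*} [NormedAddCommGroup E] [InnerProductSpace ℂ E] [CompleteSpace E]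

/-- The closed subspace `K` is invariant under the unitary `V` and its inverse. -/
structure Reduces (V : unitary (E →L[ℂ] E)) (K : Submodule ℂ E) : Prop where
  isClosed : IsClosed (K : Set E)
  apply_mem : ∀ x ∈ K, (V : E →L[ℂ] E) x ∈ K
  star_apply_mem : ∀ x ∈ K, star (V : E →L[ℂ] E) x ∈ K

theorem Reduces.orthogonal {V : unitary (E →L[ℂ] E)} {K : Submodule ℂ E} (h : Reduces V K) :
    Reduces V Kᗮ where
  isClosed := K.isClosed_orthogonal
  apply_mem x hx := by
    rw [Submodule.mem_orthogonal] at hx ⊢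
    intro u hu
    rw [← ContinuousLinearMap.adjoint_inner_left, ← ContinuousLinearMap.star_eq_adjoint]
    exact hx _ (h.star_apply_mem u hu)
  star_apply_mem x hx := by
    rw [Submodule.mem_orthogonal] at hx ⊢
    intro u hu
    rw [ContinuousLinearMap.star_eq_adjoint, ContinuousLinearMap.adjoint_inner_right]
    exact hx _ (h.apply_mem u hu)

theorem Reduces.inf {V : unitary (E →L[ℂ] E)} {K L : Submodule ℂ E} (h : Reduces V K)
    (h' : Reduces V L) : Reduces V (K ⊓ L) where
  isClosed := h.isClosed.inter h'.isClosed
  apply_mem x hx := ⟨h.apply_mem x hx.1, h'.apply_mem x hx.2⟩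
  star_apply_mem x hx := ⟨h.star_apply_mem x hx.1, h'.star_apply_mem x hx.2⟩

theorem reduces_topologicalClosure {V : unitary (E →L[ℂ] E)} {K : Submodule ℂ E}
    (h : ∀ x ∈ K, (V : E →L[ℂ] E) x ∈ K.topologicalClosure)
    (h' : ∀ x ∈ K, star (V : E →L[ℂ] E) x ∈ K.topologicalClosure) :
    Reduces V K.topologicalClosure where
  isClosed := K.isClosed_topologicalClosure
  apply_mem := fun _ hx => closure_minimal (t := {x | (V : E →L[ℂ] E) x ∈ K.topologicalClosure}) h
    (K.isClosed_topologicalClosure.preimage (V : E →L[ℂ] E).continuous) hx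
  star_apply_mem := fun _ hx => closure_minimal
    (t := {x | star (V : E →L[ℂ] E) x ∈ K.topologicalClosure}) h'
    (K.isClosed_topologicalClosure.preimage (star (V : E →L[ℂ] E)).continuous) hx

theorem Reduces.intertwines {V : unitary (E →L[ℂ] E)} {K : Submodule ℂ E} [CompleteSpace K]
    (h : Reduces V K) :
    K.starProjection ∘L (V : E →L[ℂ] E) = (V : E →L[ℂ] E) ∘L K.starProjection := by
  ext x
  refine Submodule.eq_starProjection_of_mem_orthogonal
    (h.apply_mem _ (K.starProjection_apply_mem x)) ?_
  simpa using h.orthogonal.apply_mem _ (K.sub_starProjection_mem_orthogonal x)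

theorem reduces_of_intertwines {V : unitary (E →L[ℂ] E)} {K : Submodule ℂ E} [CompleteSpace K]
    (h : K.starProjection ∘L (V : E →L[ℂ] E) = (V : E →L[ℂ] E) ∘L K.starProjection) :
    Reduces V K where
  isClosed := (completeSpace_coe_iff_isComplete.mp ‹CompleteSpace K›).isClosed
  apply_mem x hx := by
    have h1 := congrArg (fun A : E →L[ℂ] E => A x) h
    simp only [ContinuousLinearMap.comp_apply, K.starProjection_eq_self_iff.mpr hx] at h1
    exact K.starProjection_eq_self_iff.mp h1
  star_apply_mem x hx := by
    have h1 := congrArg (fun A : E →L[ℂ] E => A x) (intertwines_star h)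
    simp only [ContinuousLinearMap.comp_apply, K.starProjection_eq_self_iff.mpr hx] at h1
    exact K.starProjection_eq_self_iff.mp h1

variable {T : E →ₗ.[ℂ] E} {hT : IsSelfAdjoint T}

theorem Reduces.starProjection_mem_graph {K : Submodule ℂ E} [CompleteSpace K]
    (h : Reduces (cayley T hT) K) {x y : E} (hxy : (x, y) ∈ T.graph) :
    (K.starProjection x, K.starProjection y) ∈ T.graph := by
  have h1 := congrArg (fun A : E →L[ℂ] E => A (y + Complex.I • x)) h.intertwines
  simp only [ContinuousLinearMap.comp_apply, cayley_spec T hT hxy] at h1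
  rw [← cayley_apply_eq_iff T hT]
  simpa using h1.symm

theorem Reduces.mem_of_mem_graph {K : Submodule ℂ E} (h : Reduces (cayley T hT) K) {x y : E}
    (hx : x ∈ K) (hxy : (x, y) ∈ T.graph) : y ∈ K := by
  have : CompleteSpace K := h.isClosed.completeSpace_coe
  have h1 := h.starProjection_mem_graph hxy
  rw [K.starProjection_eq_self_iff.mpr hx] at h1
  exact K.starProjection_eq_self_iff.mp (T.mem_graph_snd_inj hxy h1 rfl).symm

/-- The criterion used for block operators, whose graphs are explicit while their Cayley transforms
are not. -/
theorem reduces_of_starProjection_mem_graph {K : Submodule ℂ E} [CompleteSpace K]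
    (h : ∀ x y, (x, y) ∈ T.graph → (K.starProjection x, K.starProjection y) ∈ T.graph) :
    Reduces (cayley T hT) K :=
  reduces_of_intertwines (intertwines_cayley hT hT h)

theorem Reduces.ccCalculus_mem {K : Submodule ℂ E} (h : Reduces (cayley T hT) K)
    (f : C_c(ℝ, ℂ)) {x : E} (hx : x ∈ K) : ccCalculus T hT f x ∈ K := by
  have : CompleteSpace K := h.isClosed.completeSpace_coe
  have h1 := congrArg (fun A : E →L[ℂ] E => A x) (intertwines_ccCalculus hT hT h.intertwines f)
  simp only [ContinuousLinearMap.comp_apply, K.starProjection_eq_self_iff.mpr hx] at h1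
  exact K.starProjection_eq_self_iff.mp h1

theorem Reduces.orbit_le {K : Submodule ℂ E} (h : Reduces (cayley T hT) K) {S : Set E}
    (hS : S ⊆ K) : orbit T hT S ≤ K := by
  refine Submodule.topologicalClosure_minimal _ (Submodule.span_le.mpr ?_) h.isClosed
  rintro w ⟨f, v, hv, rfl⟩
  exact h.ccCalculus_mem f (hS hv)

/-- On the unit circle the inverse Cayley map is already real, so taking the real part in
`circleFun` changes nothing. -/
theorem circleFun_real (z : ℂ) (hz : z ∈ Metric.sphere (0 : ℂ) 1) (h1 : z ≠ 1) :
    (((Complex.I * (1 + z) / (1 - z)).re : ℝ) + Complex.I) * (1 - z) = 2 * Complex.I := by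
  have hn : z * (starRingEnd ℂ) z = 1 := by
    rw [Complex.mul_conj, Complex.normSq_eq_norm_sq]
    simp only [mem_sphere_iff_norm, sub_zero] at hz
    simp [hz]
  have hd : 1 - z ≠ 0 := sub_ne_zero.mpr (Ne.symm h1)
  have hd' : 1 - (starRingEnd ℂ) z ≠ 0 := by
    have := (map_ne_zero (starRingEnd ℂ)).mpr hd
    simpa using this
  have hre : (((Complex.I * (1 + z) / (1 - z)).re : ℝ) : ℂ) = Complex.I * (1 + z) / (1 - z) := by
    rw [← Complex.conj_eq_iff_re]
    simp only [map_div₀, map_mul, map_add, map_sub, Complex.conj_I, map_one]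
    rw [div_eq_div_iff hd' hd]
    linear_combination (2 * Complex.I) * hn
  rw [hre]
  field_simp
  ring

/-- The product of `f ∈ C_c(ℝ)` with a continuous function. -/
noncomputable def mulContinuous (f : C_c(ℝ, ℂ)) (h : C(ℝ, ℂ)) : C_c(ℝ, ℂ) :=
  ⟨f.toContinuousMap * h, f.hasCompactSupport.mul_right⟩

theorem ofReal_add_I_ne_zero (s : ℝ) : (s : ℂ) + Complex.I ≠ 0 := fun h => by
  simpa using congrArg Complex.im h

/-- In the real variable, `z = 1 - 2i / (s + i)` is continuous, and multiplying by it keeps the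
support compact. -/
theorem cayley_mul_ccCalculus (f : C_c(ℝ, ℂ)) : ∃ g : C_c(ℝ, ℂ),
    (cayley T hT : E →L[ℂ] E) * ccCalculus T hT f = ccCalculus T hT g := by
  let h : C(ℝ, ℂ) := ⟨fun s => 1 - 2 * Complex.I / (s + Complex.I),
    continuous_const.sub (continuous_const.div (by fun_prop) ofReal_add_I_ne_zero)⟩
  refine ⟨mulContinuous f h, ?_⟩
  have hU : cfc (fun z : ℂ => z) (cayley T hT : E →L[ℂ] E) = cayley T hT := cfc_id' ℂ _
  rw [ccCalculus, ccCalculus]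
  nth_rw 1 [← hU]
  rw [← cfc_mul (fun z => z) _ _ (by fun_prop) (continuousOn_spectrum T hT f)]
  refine cfc_congr fun z hz => ?_
  by_cases h1 : z = 1
  · simp [circleFun, h1]
  have h2 := circleFun_real z (spectrum.subset_circle_of_unitary (cayley T hT).2 hz) h1
  simp only [circleFun, h1, if_false]
  set s := (Complex.I * (1 + z) / (1 - z)).re
  change z * f s = f s * (1 - 2 * Complex.I / (s + Complex.I))
  rw [← h2]
  field_simp [ofReal_add_I_ne_zero s]
  ring

theorem star_ccCalculus (f : C_c(ℝ, ℂ)) : ∃ g : C_c(ℝ, ℂ),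
    star (ccCalculus T hT f) = ccCalculus T hT g := by
  refine ⟨star f, ?_⟩
  rw [ccCalculus, ccCalculus, ← cfc_star]
  refine cfc_congr fun z _ => ?_
  by_cases h1 : z = 1 <;> simp [circleFun, h1]

theorem commute_ccCalculus (f : C_c(ℝ, ℂ)) :
    Commute (cayley T hT : E →L[ℂ] E) (ccCalculus T hT f) := by
  have hU : cfc (fun z : ℂ => z) (cayley T hT : E →L[ℂ] E) = cayley T hT := cfc_id' ℂ _
  have := cfc_commute_cfc (fun z : ℂ => z) (circleFun f) (cayley T hT : E →L[ℂ] E)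
  rwa [hU] at this

theorem star_cayley_mul_ccCalculus (f : C_c(ℝ, ℂ)) : ∃ g : C_c(ℝ, ℂ),
    star (cayley T hT : E →L[ℂ] E) * ccCalculus T hT f = ccCalculus T hT g := by
  obtain ⟨f', hf'⟩ := star_ccCalculus (T := T) (hT := hT) f
  obtain ⟨g, hg⟩ := cayley_mul_ccCalculus (T := T) (hT := hT) f'
  obtain ⟨g', hg'⟩ := star_ccCalculus (T := T) (hT := hT) g
  refine ⟨g', ?_⟩
  rw [← hg', ← hg, (commute_ccCalculus f').eq, star_mul, ← hf', star_star]

theorem reduces_orbit (S : Set E) : Reduces (cayley T hT) (orbit T hT S) := by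
  refine reduces_topologicalClosure (fun x hx => Submodule.le_topologicalClosure _ ?_)
    (fun x hx => Submodule.le_topologicalClosure _ ?_)
  · refine Submodule.span_induction (p := fun x _ => (cayley T hT : E →L[ℂ] E) x ∈ _) ?_
      (by simp) (fun x y _ _ hx hy => by rw [map_add]; exact add_mem hx hy)
      (fun c x _ hx => by rw [map_smul]; exact Submodule.smul_mem _ c hx) hx
    rintro _ ⟨f, v, hv, rfl⟩
    obtain ⟨g, hg⟩ := cayley_mul_ccCalculus (T := T) (hT := hT) f
    exact Submodule.subset_span ⟨g, v, hv, congrArg (fun A : E →L[ℂ] E => A v) hg⟩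
  · refine Submodule.span_induction (p := fun x _ => star (cayley T hT : E →L[ℂ] E) x ∈ _) ?_
      (by simp) (fun x y _ _ hx hy => by rw [map_add]; exact add_mem hx hy)
      (fun c x _ hx => by rw [map_smul]; exact Submodule.smul_mem _ c hx) hx
    rintro _ ⟨f, v, hv, rfl⟩
    obtain ⟨g, hg⟩ := star_cayley_mul_ccCalculus (T := T) (hT := hT) f
    exact Submodule.subset_span ⟨g, v, hv, congrArg (fun A : E →L[ℂ] E => A v) hg⟩

/-- The factor `z - 1` vanishes at infinity, so a cutoff that is `1` on a large interval
approximates the identity once multiplied by it. -/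
theorem exists_norm_sub_mul_le {ε : ℝ} (hε : 0 < ε) : ∃ f : C_c(ℝ, ℂ),
    ∀ z ∈ Metric.sphere (0 : ℂ) 1, ‖(z - 1) - (z - 1) * circleFun f z‖ ≤ ε := by
  obtain ⟨f, hf1, hf2, -, hf3⟩ := exists_continuousMap_one_of_isCompact_subset_isOpen
    -- The radius comes from `|s + i| |1 - z| = 2`: where `|s| > 2 / ε`, already `|1 - z| ≤ ε`.
    (isCompact_closedBall (0 : ℝ) (2 / ε)) isOpen_univ (Set.subset_univ _)
  let F : C_c(ℝ, ℝ) := ⟨f, hf2⟩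
  refine ⟨toComplex F, fun z hz => ?_⟩
  by_cases h1 : z = 1
  · simp [h1, hε.le]
  have h2 := circleFun_real z hz h1
  simp only [circleFun, h1, if_false, toComplex_apply]
  set s := (Complex.I * (1 + z) / (1 - z)).re
  by_cases hs : s ∈ Metric.closedBall (0 : ℝ) (2 / ε)
  · have : F s = 1 := hf1 hs
    simp [this, hε.le]
  have hs' : 2 / ε < |s| := by simpa using hs
  have h3 : |s| ≤ ‖(s : ℂ) + Complex.I‖ := by
    simpa using Complex.abs_re_le_norm ((s : ℂ) + Complex.I)
  have h4 : ‖(s : ℂ) + Complex.I‖ * ‖1 - z‖ = 2 := by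
    rw [← norm_mul, h2]
    simp
  have h5 : ‖1 - z‖ ≤ ε := by
    by_contra! hlt
    have : 2 / ε * ε < ‖(s : ℂ) + Complex.I‖ * ‖1 - z‖ :=
      mul_lt_mul'' (hs'.trans_le h3) hlt (by positivity) hε.le
    rw [h4, div_mul_cancel₀ _ hε.ne'] at this
    exact lt_irrefl _ this
  have h6 : ‖(1 : ℂ) - (F s : ℂ)‖ ≤ 1 := by
    rw [← Complex.ofReal_one, ← Complex.ofReal_sub, Complex.norm_real, Real.norm_eq_abs]
    have := hf3 s
    exact abs_le.mpr ⟨by linarith [show F s ≤ 1 from this.2], by linarith [show 0 ≤ F s from this.1]⟩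
  calc ‖(z - 1) - (z - 1) * (F s : ℂ)‖ = ‖1 - z‖ * ‖1 - (F s : ℂ)‖ := by
        rw [← norm_neg, ← norm_mul]
        ring_nf
    _ ≤ ε * 1 := by gcongr
    _ = ε := mul_one _

/-- Nondegeneracy of the calculus: `(U - 1) u` is unchanged when `(U - 1) f(T)` is subtracted from
`U - 1`, and the difference can be made arbitrarily small in norm. Hence `U u = u`, which forces `u
= 0`. -/
theorem eq_zero_of_forall_ccCalculus_eq_zero {u : E}
    (h : ∀ f : C_c(ℝ, ℂ), ccCalculus T hT f u = 0) : u = 0 := by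
  refine eq_zero_of_cayley_apply_eq_self (T := T) (hT := hT) (sub_eq_zero.mp ?_)
  rw [← norm_eq_zero]
  refine le_antisymm (le_of_forall_pos_le_add fun ε hε => ?_) (norm_nonneg _)
  obtain ⟨f, hf⟩ := exists_norm_sub_mul_le (ε := ε / (‖u‖ + 1)) (by positivity)
  set U := (cayley T hT : E →L[ℂ] E) with hUdef
  have hU : cfc (fun z : ℂ => z) U = U := cfc_id' ℂ _
  have hcont := continuousOn_spectrum T hT f
  have h1 : cfc (fun z => (z - 1) - (z - 1) * circleFun f z) U =
      (U - 1) - (U - 1) * ccCalculus T hT f := by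
    have h2 : cfc (fun z : ℂ => z - 1) U = U - 1 := by
      rw [cfc_sub _ _ U (by fun_prop) (by fun_prop), hU]
      congr 1
      exact cfc_const_one ℂ U
    have h3 : ContinuousOn (fun z : ℂ => z - 1) (spectrum ℂ U) := by fun_prop
    rw [cfc_sub (fun z => z - 1) (fun z => (z - 1) * circleFun f z) U h3 (h3.mul hcont),
      cfc_mul (fun z => z - 1) _ U h3 hcont, h2, ccCalculus]
  have h3 : ‖(U - 1) - (U - 1) * ccCalculus T hT f‖ ≤ ε / (‖u‖ + 1) := by
    rw [← h1]
    exact norm_cfc_le (by positivity) fun z hz =>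
      hf z (spectrum.subset_circle_of_unitary (cayley T hT).2 hz)
  have h4 : U u - u = ((U - 1) - (U - 1) * ccCalculus T hT f) u := by
    simp [h f]
  rw [h4, zero_add]
  calc _ ≤ ε / (‖u‖ + 1) * ‖u‖ := (ContinuousLinearMap.le_opNorm _ _).trans (by gcongr)
    _ ≤ ε / (‖u‖ + 1) * (‖u‖ + 1) := by gcongr; linarith
    _ = ε := by field_simp

/-- The projection onto the orbit commutes with each `f(T)` and fixes `f(T) v`. So every `f(T)`
kills the component of `v` orthogonal to the orbit, and nondegeneracy applies. -/
theorem subset_orbit (S : Set E) : S ⊆ orbit T hT S := by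
  intro v hv
  have hr := reduces_orbit (T := T) (hT := hT) S
  have : CompleteSpace (orbit T hT S) := hr.isClosed.completeSpace_coe
  have h0 : v - (orbit T hT S).starProjection v = 0 := by
    refine eq_zero_of_forall_ccCalculus_eq_zero (T := T) (hT := hT) fun f => ?_
    have h1 := congrArg (fun A : E →L[ℂ] E => A v) (intertwines_ccCalculus hT hT hr.intertwines f)
    simp only [ContinuousLinearMap.comp_apply] at h1
    rw [map_sub, ← h1, sub_eq_zero, eq_comm, Submodule.starProjection_eq_self_iff]
    exact Submodule.le_topologicalClosure _ (Submodule.subset_span ⟨f, v, hv, rfl⟩)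
  exact Submodule.starProjection_eq_self_iff.mp (sub_eq_zero.mp h0).symm

theorem isInvariant_iff_reduces {K : Submodule ℂ E} :
    IsInvariant T hT K ↔ Reduces (cayley T hT) K := by
  refine ⟨fun h => ?_, fun h => le_antisymm (h.orbit_le subset_rfl) (subset_orbit _)⟩
  rw [IsInvariant] at h
  rw [← h]
  exact reduces_orbit _

theorem le_orthogonal_orbit {K : Submodule ℂ E} (h : Reduces (cayley T hT) K) {S : Submodule ℂ E}
    (hS : K ≤ Sᗮ) : K ≤ (orbit T hT S)ᗮ := by
  exact Submodule.IsOrtho.symm (h.orthogonal.orbit_le (Submodule.IsOrtho.symm hS))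

end Reducing

/-! ### Polarization and density of eigenvectors -/

section InnerProduct

variable {E : Type*} [NormedAddCommGroup E] [InnerProductSpace ℂ E]

/-- Polarization is needed because spectral measures give only diagonal matrix elements. -/
theorem four_mul_inner_apply (A : E →L[ℂ] E) (w v : E) : 4 * ⟪w, A v⟫_ℂ =
    ⟪w + v, A (w + v)⟫_ℂ - ⟪w - v, A (w - v)⟫_ℂ
      - Complex.I * (⟪w + Complex.I • v, A (w + Complex.I • v)⟫_ℂ
        - ⟪w - Complex.I • v, A (w - Complex.I • v)⟫_ℂ) := by
  simp only [map_add, map_sub, map_smul, inner_add_left, inner_add_right, inner_sub_left,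
    inner_sub_right, inner_smul_left, inner_smul_right, Complex.conj_I]
  linear_combination (2 * ⟪w, A v⟫_ℂ - 2 * ⟪v, A w⟫_ℂ) * Complex.I_mul_I

theorem HasPurePointSpectrum.eq_zero {T : E →ₗ.[ℂ] E} (hpp : HasPurePointSpectrum T) {u : E}
    (h : ∀ z, ∀ e ∈ eigenspace T z, ⟪e, u⟫_ℂ = 0) : u = 0 := by
  have h1 : u ∈ ((⨆ z, eigenspace T z).topologicalClosure)ᗮ := by
    rw [Submodule.orthogonal_closure, ← Submodule.iInf_orthogonal, Submodule.mem_iInf]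
    exact fun z => (Submodule.mem_orthogonal _ _).mpr (h z)
  rw [hpp, Submodule.top_orthogonal_eq_bot] at h1
  exact (Submodule.mem_bot ℂ).mp h1

end InnerProduct

/-! ### Orbits through spectral projections -/

section SpectralSpan

variable {E : Type*} [NormedAddCommGroup E] [InnerProductSpace ℂ E] [CompleteSpace E]

variable {T : E →ₗ.[ℂ] E} {hT : IsSelfAdjoint T}

theorem inner_ccCalculus_toComplex (f : C_c(ℝ, ℝ)) (v : E) :
    ⟪v, ccCalculus T hT (toComplex f) v⟫_ℂ = ((∫ x, f x ∂(spectralMeasure T hT v) : ℝ) : ℂ) := by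
  have h : star (ccCalculus T hT (toComplex f)) = ccCalculus T hT (toComplex f) := by
    rw [ccCalculus, ← cfc_star]
    refine cfc_congr fun z _ => ?_
    by_cases h1 : z = 1 <;> simp [circleFun, h1]
  rw [integral_spectralMeasure, eq_comm, ← Complex.conj_eq_iff_re, inner_conj_symm,
    ← ContinuousLinearMap.adjoint_inner_right, ← ContinuousLinearMap.star_eq_adjoint, h]

theorem ccCalculus_eq_re_add_im (f : C_c(ℝ, ℂ)) : ∃ g h : C_c(ℝ, ℝ), ccCalculus T hT f =
    ccCalculus T hT (toComplex g) + Complex.I • ccCalculus T hT (toComplex h) := by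
  let g : C_c(ℝ, ℝ) := f.compLeft ⟨Complex.re, Complex.continuous_re⟩
  let h : C_c(ℝ, ℝ) := f.compLeft ⟨Complex.im, Complex.continuous_im⟩
  have hg : ∀ x, g x = (f x).re := fun x => by
    simp [g, CompactlySupportedContinuousMap.compLeft_apply]
  have hh : ∀ x, h x = (f x).im := fun x => by
    simp [h, CompactlySupportedContinuousMap.compLeft_apply]
  refine ⟨g, h, ?_⟩
  rw [ccCalculus, ccCalculus, ccCalculus,
    ← cfc_smul Complex.I _ _ (continuousOn_spectrum T hT _),
    ← cfc_add _ (circleFun (toComplex g)) (fun x => Complex.I • circleFun (toComplex h) x)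
      (continuousOn_spectrum T hT _) ((continuousOn_spectrum T hT _).const_smul Complex.I)]
  refine cfc_congr fun z _ => ?_
  by_cases h1 : z = 1
  · simp [circleFun, h1]
  · simp only [circleFun, h1, if_false, toComplex_apply, hg, hh, smul_eq_mul]
    simp only [mul_comm Complex.I, Complex.re_add_im]

theorem inner_ccCalculus_congr {v w : E} (h : spectralMeasure T hT v = spectralMeasure T hT w)
    (f : C_c(ℝ, ℂ)) : ⟪v, ccCalculus T hT f v⟫_ℂ = ⟪w, ccCalculus T hT f w⟫_ℂ := by
  obtain ⟨a, b, hab⟩ := ccCalculus_eq_re_add_im (T := T) (hT := hT) f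
  simp only [hab, add_apply, smul_apply, inner_add_right,
    inner_smul_right, inner_ccCalculus_toComplex, h]

theorem Reduces.inner_ccCalculus_add_smul {K : Submodule ℂ E} (h : Reduces (cayley T hT) K)
    {w v : E} (hw : w ∈ Kᗮ) (hv : v ∈ K) (c : ℂ) (f : C_c(ℝ, ℂ)) :
    ⟪w + c • v, ccCalculus T hT f (w + c • v)⟫_ℂ = ⟪w, ccCalculus T hT f w⟫_ℂ +
      (starRingEnd ℂ) c * c * ⟪v, ccCalculus T hT f v⟫_ℂ := by
  have h1 : ⟪w, ccCalculus T hT f v⟫_ℂ = 0 :=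
    Submodule.inner_left_of_mem_orthogonal (h.ccCalculus_mem f hv) hw
  have h2 : ⟪v, ccCalculus T hT f w⟫_ℂ = 0 :=
    Submodule.inner_right_of_mem_orthogonal hv (h.orthogonal.ccCalculus_mem f hw)
  simp only [map_add, map_smul, inner_add_left, inner_add_right, inner_smul_left,
    inner_smul_right, h1, h2]
  ring

/-- For `w` orthogonal to `K` and `v` in `K` the cross terms vanish, so the spectral measure of `w +
c v` depends on `|c|` only. In the polarization of `⟪w, g(T) v⟫` the terms therefore cancel in
pairs. -/
theorem Reduces.borelCalculus_mem {K : Submodule ℂ E} (h : Reduces (cayley T hT) K) {g : ℝ → ℂ}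
    (hg : Measurable g) {C : ℝ} (hC : ∀ x, ‖g x‖ ≤ C) {v : E} (hv : v ∈ K) :
    borelCalculus T hT g v ∈ K := by
  have : CompleteSpace K := h.isClosed.completeSpace_coe
  rw [← Submodule.orthogonal_orthogonal K, Submodule.mem_orthogonal]
  intro w hw
  have hm : ∀ c d : ℂ, ‖c‖ = 1 → ‖d‖ = 1 →
      spectralMeasure T hT (w + c • v) = spectralMeasure T hT (w + d • v) := fun c d hc hd =>
    spectralMeasure_congr hT hT fun f => by
      rw [h.inner_ccCalculus_add_smul hw hv, h.inner_ccCalculus_add_smul hw hv,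
        Complex.conj_mul', Complex.conj_mul', hc, hd]
  have h1 := hm 1 (-1) (by simp) (by simp)
  have h2 := hm Complex.I (-Complex.I) (by simp) (by simp)
  simp only [one_smul, neg_smul, ← sub_eq_add_neg] at h1 h2
  have h4 := four_mul_inner_apply (borelCalculus T hT g) w v
  rw [inner_borelCalculus T hT hg hC, inner_borelCalculus T hT hg hC,
    inner_borelCalculus T hT hg hC, inner_borelCalculus T hT hg hC, h1, h2] at h4
  simpa using h4

/-- Tile the line by half-open intervals of length `ε`; within a tile every interval is short. -/
theorem measure_eq_of_short_Ioc {μ ν : Measure ℝ} [IsFiniteMeasure μ] [IsFiniteMeasure ν] {ε : ℝ}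
    (hε : 0 < ε) (h : ∀ a b, b ≤ a + ε → μ (Set.Ioc a b) = ν (Set.Ioc a b)) : μ = ν := by
  refine Measure.ext_of_iUnion_eq_univ (iUnion_Ioc_zsmul hε) fun n => ?_
  refine Measure.ext_of_Ioc _ _ fun a b _ => ?_
  rw [Measure.restrict_apply measurableSet_Ioc, Measure.restrict_apply measurableSet_Ioc,
    Set.Ioc_inter_Ioc]
  refine h _ _ ?_
  have h1 : (n + 1) • ε = n • ε + ε := by rw [add_smul, one_smul]
  have h2 := le_max_right a (n • ε)
  have h3 := min_le_right b ((n + 1) • ε)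
  linarith

theorem inner_spectralProjection {Δ : Set ℝ} (hΔ : MeasurableSet Δ) (v : E) :
    ⟪v, spectralProjection T hT Δ v⟫_ℂ = (((spectralMeasure T hT v).real Δ : ℝ) : ℂ) := by
  rw [spectralProjection, inner_borelCalculus T hT (C := 1) (measurable_const.indicator hΔ),
    integral_indicator hΔ]
  · simp
  · intro x
    by_cases hx : x ∈ Δ <;> simp [hx]

/-- All four terms of the polarization identity are real up to the explicit factor `i`, so its real
and imaginary parts give the two equalities. -/
theorem spectralMeasure_eq_of_inner_spectralProjection_eq_zero {w v : E} {Δ : Set ℝ}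
    (hΔ : MeasurableSet Δ) (h : ⟪w, spectralProjection T hT Δ v⟫_ℂ = 0) :
    spectralMeasure T hT (w + v) Δ = spectralMeasure T hT (w - v) Δ ∧
      spectralMeasure T hT (w + Complex.I • v) Δ = spectralMeasure T hT (w - Complex.I • v) Δ := by
  have h4 := four_mul_inner_apply (spectralProjection T hT Δ) w v
  rw [h] at h4
  simp only [inner_spectralProjection hΔ] at h4
  have hre := congrArg Complex.re h4
  have him := congrArg Complex.im h4
  simp at hre him
  refine ⟨(measureReal_eq_measureReal_iff).mp ?_, (measureReal_eq_measureReal_iff).mp ?_⟩ <;>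
    linarith

theorem spectralProjection_mem_spectralSpan {D : Set (Set ℝ)} {Δ : Set ℝ} (hΔ : Δ ∈ D)
    {S : Set E} {v : E} (hv : v ∈ S) :
    spectralProjection T hT Δ v ∈ spectralSpan T hT D S :=
  Submodule.le_topologicalClosure _ (Submodule.subset_span ⟨Δ, hΔ, v, hv, rfl⟩)

/-- The closed orbit of `S` is spanned by the spectral projections, over any family of measurable
sets that contains the short intervals, of the vectors in `S`. -/
theorem orbit_eq_spectralSpan {D : Set (Set ℝ)} (hD : ∀ Δ ∈ D, MeasurableSet Δ) {ε : ℝ}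
    (hε : 0 < ε) (hDε : ∀ a b, b ≤ a + ε → Set.Ioc a b ∈ D) (S : Set E) :
    orbit T hT S = spectralSpan T hT D S := by
  refine le_antisymm ?_ ?_
  · refine Submodule.topologicalClosure_minimal _ (Submodule.span_le.mpr ?_)
      (Submodule.isClosed_topologicalClosure _)
    rintro _ ⟨f, v, hv, rfl⟩
    have hcl : IsClosed (spectralSpan T hT D S : Set E) := Submodule.isClosed_topologicalClosure _
    have : CompleteSpace (spectralSpan T hT D S) := hcl.completeSpace_coe
    change _ ∈ spectralSpan T hT D S
    -- By duality it is enough that `w` orthogonal to the span is orthogonal to `f(T) v`.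
    -- Orthogonality to the short spectral projections of `v` makes the polarized measures agree,
    -- and these determine `⟪w, f(T) v⟫`.
    rw [← Submodule.orthogonal_orthogonal (spectralSpan T hT D S), Submodule.mem_orthogonal]
    intro w hw
    have h0 : ∀ a b, b ≤ a + ε → ⟪w, spectralProjection T hT (Set.Ioc a b) v⟫_ℂ = 0 :=
      fun a b hab => Submodule.inner_left_of_mem_orthogonal
        (spectralProjection_mem_spectralSpan (hDε a b hab) hv) hw
    have h1 : spectralMeasure T hT (w + v) = spectralMeasure T hT (w - v) :=
      measure_eq_of_short_Ioc hε fun a b hab =>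
        (spectralMeasure_eq_of_inner_spectralProjection_eq_zero measurableSet_Ioc (h0 a b hab)).1
    have h2 : spectralMeasure T hT (w + Complex.I • v) =
        spectralMeasure T hT (w - Complex.I • v) :=
      measure_eq_of_short_Ioc hε fun a b hab =>
        (spectralMeasure_eq_of_inner_spectralProjection_eq_zero measurableSet_Ioc (h0 a b hab)).2
    have h4 := four_mul_inner_apply (ccCalculus T hT f) w v
    rw [inner_ccCalculus_congr h1, inner_ccCalculus_congr h2] at h4
    simpa using h4
  · refine Submodule.topologicalClosure_minimal _ (Submodule.span_le.mpr ?_)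
      (Submodule.isClosed_topologicalClosure _)
    rintro _ ⟨Δ, hΔ, v, hv, rfl⟩
    refine (reduces_orbit S).borelCalculus_mem (C := 1) (measurable_const.indicator (hD Δ hΔ))
      (fun x => ?_) (subset_orbit S hv)
    by_cases hx : x ∈ Δ <;> simp [hx]

theorem orbit_eq_spectralSpan_intervals (S : Set E) :
    orbit T hT S = spectralSpan T hT intervals S :=
  -- The length `1` is arbitrary, as all intervals are allowed.
  orbit_eq_spectralSpan (fun _ h => Set.OrdConnected.measurableSet h) one_pos
    (fun _ _ _ => Set.ordConnected_Ioc) S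

theorem orbit_eq_spectralSpan_intervalsOfLength {ε : ℝ} (hε : 0 < ε) (S : Set E) :
    orbit T hT S = spectralSpan T hT (intervalsOfLength ε) S :=
  orbit_eq_spectralSpan (D := intervalsOfLength ε) (fun _ h => h.1.measurableSet) hε
    (fun a _ hab => ⟨Set.ordConnected_Ioc, a, fun _ hx => ⟨hx.1.le, hx.2.trans hab⟩⟩) S

end SpectralSpan

/-! ### Pure point spectrum -/

section PointSpectrum

variable {E : Type*} [NormedAddCommGroup E] [InnerProductSpace ℂ E] [CompleteSpace E]
  {T : E →ₗ.[ℂ] E} {hT : IsSelfAdjoint T}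

theorem inner_eq_of_mem_graph (hT : IsSelfAdjoint T) {x y a b : E} (h : (x, y) ∈ T.graph)
    (h' : (a, b) ∈ T.graph) : ⟪b, x⟫_ℂ = ⟪a, y⟫_ℂ :=
  (mem_graph_iff_of_isSelfAdjoint hT x y).mp h a b h'

theorem conj_eq_of_mem_eigenspace (hT : IsSelfAdjoint T) {z : ℂ} {φ : E}
    (h : φ ∈ eigenspace T z) (h0 : φ ≠ 0) : (starRingEnd ℂ) z = z := by
  have h1 := inner_eq_of_mem_graph hT h h
  change ⟪z • φ, φ⟫_ℂ = ⟪φ, z • φ⟫_ℂ at h1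
  rw [inner_smul_left, inner_smul_right] at h1
  exact mul_right_cancel₀ (inner_self_ne_zero.mpr h0) h1

theorem eigenspace_isOrtho (hT : IsSelfAdjoint T) {z z' : ℂ} (hz : z ≠ z') :
    eigenspace T z ⟂ eigenspace T z' := by
  rw [Submodule.isOrtho_iff_inner_eq]
  intro u hu v hv
  by_cases h0 : u = 0
  · simp [h0]
  have h1 := inner_eq_of_mem_graph hT hv hu
  change ⟪z • u, v⟫_ℂ = ⟪u, z' • v⟫_ℂ at h1
  rw [inner_smul_left, inner_smul_right, conj_eq_of_mem_eigenspace hT hu h0, ← sub_eq_zero,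
    ← sub_mul] at h1
  exact (mul_eq_zero.mp h1).resolve_left (sub_ne_zero.mpr hz)

/-- Unit eigenvectors for distinct eigenvalues lie at distance `√2`, so balls of radius `1/2` around
them are disjoint. -/
theorem countable_eigenvalues [TopologicalSpace.SeparableSpace E] (hT : IsSelfAdjoint T) :
    (eigenvalues T).Countable := by
  have h : ∀ z : eigenvalues T, ∃ v ∈ eigenspace T z, ‖v‖ = 1 := fun z => by
    obtain ⟨v, hv, h0⟩ := Submodule.exists_mem_ne_zero_of_ne_bot z.2
    refine ⟨(((‖v‖⁻¹ : ℝ) : ℂ)) • v, Submodule.smul_mem _ _ hv, ?_⟩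
    rw [norm_smul, Complex.norm_real, norm_inv, norm_norm, inv_mul_cancel₀ (norm_ne_zero_iff.mpr h0)]
  choose v hv hn using h
  have hd : Pairwise (Function.onFun Disjoint fun z => Metric.ball (v z) (1 / 2)) := by
    intro z z' hz
    refine Metric.ball_disjoint_ball ?_
    have h1 : ⟪v z, v z'⟫_ℂ = 0 := (Submodule.isOrtho_iff_inner_eq.mp
      (eigenspace_isOrtho hT fun h => hz (Subtype.ext h))) _ (hv z) _ (hv z')
    have h2 := norm_sub_sq (𝕜 := ℂ) (v z) (v z')
    rw [h1, hn, hn, ← dist_eq_norm] at h2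
    simp at h2
    nlinarith [dist_nonneg (x := v z) (y := v z')]
  have := Pairwise.countable_of_isOpen_disjoint hd (fun _ => Metric.isOpen_ball)
    fun z => Metric.nonempty_ball.mpr (by norm_num)
  exact Set.countable_coe_iff.mp this

/-- An eigenvalue is real, so `z ± i` is nonzero and `U` multiplies `φ` by `(z - i) / (z + i)`. -/
theorem cayley_apply_mem_span {z : ℂ} {φ : E} (h : φ ∈ eigenspace T z) :
    (cayley T hT : E →L[ℂ] E) φ ∈ Submodule.span ℂ {φ} ∧
      star (cayley T hT : E →L[ℂ] E) φ ∈ Submodule.span ℂ {φ} := by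
  by_cases h0 : φ = 0
  · simp [h0]
  have h1 := cayley_spec T hT h
  change (cayley T hT : E →L[ℂ] E) (z • φ + Complex.I • φ) = z • φ - Complex.I • φ at h1
  rw [← add_smul, ← sub_smul] at h1
  have hz := conj_eq_of_mem_eigenspace hT h h0
  rw [Complex.conj_eq_iff_im] at hz
  have hp : z + Complex.I ≠ 0 := fun h => by simpa [hz] using congrArg Complex.im h
  have hm : z - Complex.I ≠ 0 := fun h => by simpa [hz] using congrArg Complex.im h
  constructor
  · refine Submodule.mem_span_singleton.mpr ⟨(z + Complex.I)⁻¹ * (z - Complex.I), ?_⟩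
    rw [mul_smul, ← h1, map_smul, smul_smul, inv_mul_cancel₀ hp, one_smul]
  · refine Submodule.mem_span_singleton.mpr ⟨(z - Complex.I)⁻¹ * (z + Complex.I), ?_⟩
    have h2 := congrArg (fun x => star (cayley T hT : E →L[ℂ] E) x) h1
    simp only [unitary_star_apply_apply, map_smul] at h2
    rw [mul_smul, h2, smul_smul, inv_mul_cancel₀ hm, one_smul]

theorem reduces_span_eigenvector {z : ℂ} {φ : E} (h : φ ∈ eigenspace T z) :
    Reduces (cayley T hT) (Submodule.span ℂ {φ}) where
  isClosed := Submodule.closed_of_finiteDimensional _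
  apply_mem x hx := by
    obtain ⟨c, rfl⟩ := Submodule.mem_span_singleton.mp hx
    rw [map_smul]
    exact Submodule.smul_mem _ _ (cayley_apply_mem_span h).1
  star_apply_mem x hx := by
    obtain ⟨c, rfl⟩ := Submodule.mem_span_singleton.mp hx
    rw [map_smul]
    exact Submodule.smul_mem _ _ (cayley_apply_mem_span h).2

theorem reduces_iSup_of_le_eigenspace {ι : Type*} {z : ι → ℂ} {V : ι → Submodule ℂ E}
    (h : ∀ i, V i ≤ eigenspace T (z i)) : Reduces (cayley T hT) (⨆ i, V i).topologicalClosure := by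
  have hspan : ∀ i, ∀ x ∈ V i, Submodule.span ℂ {x} ≤ (⨆ i, V i).topologicalClosure :=
    fun i x hx => (Submodule.span_singleton_le_iff_mem _ _).mpr
      (Submodule.le_topologicalClosure _ (Submodule.mem_iSup_of_mem i hx))
  refine reduces_topologicalClosure (fun x hx => ?_) (fun x hx => ?_)
  · refine Submodule.iSup_induction V (motive := fun x => (cayley T hT : E →L[ℂ] E) x ∈ _) hx
      (fun i x hx => hspan i x hx (cayley_apply_mem_span (h i hx)).1) (by simp)
      (fun x y hx hy => by rw [map_add]; exact add_mem hx hy)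
  · refine Submodule.iSup_induction V (motive := fun x => star (cayley T hT : E →L[ℂ] E) x ∈ _) hx
      (fun i x hx => hspan i x hx (cayley_apply_mem_span (h i hx)).2) (by simp)
      (fun x y hx hy => by rw [map_add]; exact add_mem hx hy)

theorem Reduces.starProjection_mem_eigenspace {K : Submodule ℂ E} [CompleteSpace K]
    (h : Reduces (cayley T hT) K) {z : ℂ} {φ : E} (hφ : φ ∈ eigenspace T z) :
    K.starProjection φ ∈ eigenspace T z := by
  have h1 := h.starProjection_mem_graph hφ
  rwa [LinearMap.smul_apply, map_smul] at h1

theorem eigenProjection_mem (z : ℂ) (x : E) : eigenProjection T hT z x ∈ eigenspace T z := by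
  have : CompleteSpace (eigenspace T z) := (isClosed_eigenspace hT z).completeSpace_coe
  exact Submodule.starProjection_apply_mem (eigenspace T z) x

theorem inner_eigenProjection {z : ℂ} {e : E} (he : e ∈ eigenspace T z) (x : E) :
    ⟪e, eigenProjection T hT z x⟫_ℂ = ⟪e, x⟫_ℂ := by
  have : CompleteSpace (eigenspace T z) := (isClosed_eigenspace hT z).completeSpace_coe
  change ⟪e, (eigenspace T z).starProjection x⟫_ℂ = _
  rw [← Submodule.inner_starProjection_left_eq_right, Submodule.starProjection_eq_self_iff.mpr he]

theorem projectedEigenspace_le_eigenspace (S : Submodule ℂ E) (z : ℂ) :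
    projectedEigenspace T hT S z ≤ eigenspace T z := by
  rintro _ ⟨x, -, rfl⟩
  exact eigenProjection_mem z x

/-- With `e` the eigencomponent of `x`, the part `d` of `e` orthogonal to `K` is again in the
eigenspace. Thus `⟪d, e⟫ = ⟪d, x⟫ = 0`, and `d = 0`. -/
theorem Reduces.eigenProjection_mem {K : Submodule ℂ E} (h : Reduces (cayley T hT) K) (z : ℂ)
    {x : E} (hx : x ∈ K) : eigenProjection T hT z x ∈ K := by
  have : CompleteSpace K := h.isClosed.completeSpace_coe
  set e := eigenProjection T hT z x with he
  have hez : e ∈ eigenspace T z := OpenSystems.eigenProjection_mem z x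
  have hd : e - K.starProjection e ∈ eigenspace T z :=
    sub_mem hez (h.starProjection_mem_eigenspace hez)
  have h0 : ⟪e - K.starProjection e, e⟫_ℂ = 0 := by
    rw [he, inner_eigenProjection (hT := hT) hd]
    exact Submodule.starProjection_inner_eq_zero _ _ hx
  have h1 : ⟪e - K.starProjection e, e - K.starProjection e⟫_ℂ = 0 := by
    rw [inner_sub_right, h0, Submodule.starProjection_inner_eq_zero _ _
      (K.starProjection_apply_mem e), sub_zero]
  exact Submodule.starProjection_eq_self_iff.mp (sub_eq_zero.mp (inner_self_eq_zero.mp h1)).symm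

theorem orbit_eq_closure_iSup_projectedEigenspace (hpp : HasPurePointSpectrum T)
    (S : Submodule ℂ E) : orbit T hT S =
      (⨆ z : eigenvalues T, projectedEigenspace T hT S z).topologicalClosure := by
  refine le_antisymm ?_ ?_
  · have hr : Reduces (cayley T hT)
        (⨆ z : eigenvalues T, projectedEigenspace T hT S z).topologicalClosure :=
      reduces_iSup_of_le_eigenspace fun z => projectedEigenspace_le_eigenspace S z
    refine hr.orbit_le fun v hv => ?_
    set W := (⨆ z : eigenvalues T, projectedEigenspace T hT S z).topologicalClosure with hW
    have : CompleteSpace W := hr.isClosed.completeSpace_coe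
    refine Submodule.starProjection_eq_self_iff.mp (sub_eq_zero.mp (hpp.eq_zero
      (u := v - W.starProjection v) fun z e he => ?_)).symm
    -- With `P` the projection onto `W`: `⟪e, v - P v⟫ = ⟪e - P e, v⟫ = ⟪e - P e, π_z v⟫`, which
    -- vanishes because `π_z v` lies in `W`.
    by_cases hz : z ∈ eigenvalues T
    · have hd : e - W.starProjection e ∈ eigenspace T z :=
        sub_mem he (hr.starProjection_mem_eigenspace he)
      have hv' : eigenProjection T hT z v ∈ W := Submodule.le_topologicalClosure _
        (Submodule.mem_iSup_of_mem (⟨z, hz⟩ : eigenvalues T) ⟨v, hv, rfl⟩)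
      rw [inner_sub_right, ← Submodule.inner_starProjection_left_eq_right, ← inner_sub_left,
        ← inner_eigenProjection (hT := hT) hd]
      exact Submodule.starProjection_inner_eq_zero _ _ hv'
    · have : eigenspace T z = ⊥ := not_not.mp hz
      rw [this, Submodule.mem_bot] at he
      simp [he]
  · refine Submodule.topologicalClosure_minimal _ (iSup_le fun z => ?_)
      (Submodule.isClosed_topologicalClosure _)
    rintro _ ⟨x, hx, rfl⟩
    exact (reduces_orbit _).eigenProjection_mem z (subset_orbit _ hx)

theorem isClosedOrthogonalSum_orbit (hpp : HasPurePointSpectrum T) (S : Submodule ℂ E) :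
    IsClosedOrthogonalSum (orbit T hT S)
      (fun z : eigenvalues T => projectedEigenspace T hT S z) :=
  ⟨fun _ _ hij => (eigenspace_isOrtho hT fun h => hij (Subtype.ext h)).mono
    (projectedEigenspace_le_eigenspace S _) (projectedEigenspace_le_eigenspace S _),
    orbit_eq_closure_iSup_projectedEigenspace hpp S⟩

/-- An eigenmode orthogonal to `S` spans a reducing line, hence is orthogonal to the orbit.
Conversely, projecting eigenvectors onto the complement of the orbit gives eigenmodes orthogonal to
`S`, or zero; if always zero, density of eigenvectors kills the complement. -/
theorem orbit_eq_top_iff (hpp : HasPurePointSpectrum T) (S : Submodule ℂ E) :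
    orbit T hT S = ⊤ ↔ ∀ φ, IsEigenmode T φ → φ ∉ Sᗮ := by
  have hr := reduces_orbit (T := T) (hT := hT) S
  have : CompleteSpace (orbit T hT S) := hr.isClosed.completeSpace_coe
  refine ⟨?_, fun h => ?_⟩
  · rintro htop φ ⟨h0, z, hz⟩ hφ
    have h1 := le_orthogonal_orbit (reduces_span_eigenvector (hT := hT) hz)
      ((Submodule.span_singleton_le_iff_mem _ _).mpr hφ)
    rw [htop, Submodule.top_orthogonal_eq_bot, Submodule.span_singleton_le_iff_mem] at h1
    exact h0 h1
  · rw [← Submodule.orthogonal_eq_bot_iff, Submodule.eq_bot_iff]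
    refine fun u hu => hpp.eq_zero fun z e he => ?_
    have h1 : (orbit T hT S)ᗮ.starProjection e = 0 := by
      by_contra hne
      exact h _ ⟨hne, z, hr.orthogonal.starProjection_mem_eigenspace he⟩
        (Submodule.orthogonal_le (subset_orbit _) (Submodule.starProjection_apply_mem _ _))
    rw [← Submodule.starProjection_eq_self_iff.mpr hu,
      ← Submodule.inner_starProjection_left_eq_right, h1, inner_zero_left]

end PointSpectrum

/-! ### Parts of a self-adjoint operator in reducing subspaces -/

section Compression

variable {E F : Type*} [NormedAddCommGroup E] [InnerProductSpace ℂ E]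
  [NormedAddCommGroup F] [InnerProductSpace ℂ F]

/-- The part of the operator `T` in the image of the isometry `J`, as an operator in the domain
of `J`. -/
noncomputable def compress (T : E →ₗ.[ℂ] E) (J : F →ₗᵢ[ℂ] E) : F →ₗ.[ℂ] F :=
  (T.graph.comap (J.toLinearMap.prodMap J.toLinearMap)).toLinearPMap

theorem mem_graph_compress (T : E →ₗ.[ℂ] E) (J : F →ₗᵢ[ℂ] E) (x y : F) :
    (x, y) ∈ (compress T J).graph ↔ (J x, J y) ∈ T.graph := by
  rw [compress, Submodule.toLinearPMap_graph_eq]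
  · rfl
  · rintro ⟨x, y⟩ hxy hx
    have hx' : x = 0 := hx
    have h := T.graph_fst_eq_zero_snd (x := J x) (x' := J y) hxy (by rw [hx', map_zero])
    exact J.injective (by simpa using h)

variable [CompleteSpace E] [CompleteSpace F]

theorem adjoint_isometry_apply (J : F →ₗᵢ[ℂ] E) (x : F) :
    ContinuousLinearMap.adjoint J.toContinuousLinearMap (J x) = x :=
  ext_inner_left ℂ fun y => by
    rw [ContinuousLinearMap.adjoint_inner_right]
    exact J.inner_map_map y x

theorem isSelfAdjoint_of_graph {T : E →ₗ.[ℂ] E} (hd : Dense (T.domain : Set E))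
    (h : ∀ x y, (x, y) ∈ T.graph ↔ ∀ a b, (a, b) ∈ T.graph → ⟪b, x⟫_ℂ = ⟪a, y⟫_ℂ) :
    IsSelfAdjoint T := by
  rw [LinearPMap.isSelfAdjoint_def]
  refine LinearPMap.eq_of_eq_graph ?_
  rw [LinearPMap.adjoint_graph_eq_graph_adjoint hd]
  ext ⟨x, y⟩
  rw [Submodule.mem_adjoint_iff, h]
  simp only [sub_eq_zero]

/-- The adjoint `J†` maps the dense domain of `T` onto a dense set inside the compressed domain. As
`J J†` preserves the graph, testing against the compressed graph is as strong as testing against all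
of `T`. -/
theorem isSelfAdjoint_compress {T : E →ₗ.[ℂ] E} (hT : IsSelfAdjoint T) {J : F →ₗᵢ[ℂ] E}
    (h : ∀ x y, (x, y) ∈ T.graph →
      (J (ContinuousLinearMap.adjoint J.toContinuousLinearMap x),
        J (ContinuousLinearMap.adjoint J.toContinuousLinearMap y)) ∈ T.graph) :
    IsSelfAdjoint (compress T J) := by
  refine isSelfAdjoint_of_graph ?_ fun x y => ?_
  · have hs : Function.Surjective (ContinuousLinearMap.adjoint J.toContinuousLinearMap) :=
      fun x => ⟨J x, adjoint_isometry_apply J x⟩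
    refine (hs.denseRange.dense_image (ContinuousLinearMap.continuous _) hT.dense_domain).mono ?_
    rintro _ ⟨x, hx, rfl⟩
    obtain ⟨y, hy⟩ := LinearPMap.mem_domain_iff.mp hx
    exact LinearPMap.mem_domain_iff.mpr ⟨_, (mem_graph_compress T J _ _).mpr (h x y hy)⟩
  · rw [mem_graph_compress, mem_graph_iff_of_isSelfAdjoint hT]
    refine ⟨fun h' a b hab => ?_, fun h' a b hab => ?_⟩
    · have := h' _ _ ((mem_graph_compress T J a b).mp hab)
      rwa [J.inner_map_map, J.inner_map_map] at this
    · have := h' _ _ ((mem_graph_compress T J _ _).mpr (h a b hab))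
      rwa [ContinuousLinearMap.adjoint_inner_left, ContinuousLinearMap.adjoint_inner_left] at this

theorem isometry_adjoint_apply (J : F →ₗᵢ[ℂ] E) {L : Submodule ℂ E} [CompleteSpace L]
    (hL : LinearMap.range J.toLinearMap = L) (x : E) :
    J (ContinuousLinearMap.adjoint J.toContinuousLinearMap x) = L.starProjection x := by
  symm
  refine Submodule.eq_starProjection_of_mem_orthogonal (by rw [← hL]; exact ⟨_, rfl⟩) ?_
  rw [← hL, Submodule.mem_orthogonal]
  rintro _ ⟨y, rfl⟩
  change ⟪J y, _⟫_ℂ = 0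
  rw [inner_sub_right, J.inner_map_map, ContinuousLinearMap.adjoint_inner_right]
  exact sub_self _

theorem Reduces.map_isometry {V : unitary (E →L[ℂ] E)} {W : unitary (F →L[ℂ] F)}
    {J : F →ₗᵢ[ℂ] E} (h : J.toContinuousLinearMap ∘L (W : F →L[ℂ] F) =
      (V : E →L[ℂ] E) ∘L J.toContinuousLinearMap) {K : Submodule ℂ F} (hK : Reduces W K) :
    Reduces V (K.map J.toLinearMap) where
  isClosed := J.isometry.isClosedEmbedding.isClosedMap _ hK.isClosed
  apply_mem := by
    rintro _ ⟨x, hx, rfl⟩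
    exact ⟨_, hK.apply_mem x hx, congrArg (fun A : F →L[ℂ] E => A x) h⟩
  star_apply_mem := by
    rintro _ ⟨x, hx, rfl⟩
    exact ⟨_, hK.star_apply_mem x hx, congrArg (fun A : F →L[ℂ] E => A x) (intertwines_star h)⟩

end Compression

/-! ### Block operators and uniqueness of the minimal extension -/

section Block

variable {H : Type*} [NormedAddCommGroup H] [InnerProductSpace ℂ H]
  {A B K : Submodule ℂ H}

theorem add_eq_add_iff_of_isOrtho (hAB : B ≤ Aᗮ) {a a' : A} {b b' : B} :
    (a : H) + b = a' + b' ↔ a = a' ∧ b = b' := by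
  refine ⟨fun h => ?_, fun h => by rw [h.1, h.2]⟩
  have h1 : ((a - a' : A) : H) = ((b' - b : B) : H) := by
    push_cast
    linear_combination (norm := module) h
  have h2 : ((a - a' : A) : H) = 0 :=
    Submodule.disjoint_def.mp (Submodule.orthogonal_disjoint A) _ (a - a').2
      (h1 ▸ hAB (b' - b).2)
  have h3 : ((b' - b : B) : H) = 0 := h1 ▸ h2
  exact ⟨sub_eq_zero.mp (Subtype.ext h2), (sub_eq_zero.mp (Subtype.ext h3)).symm⟩

/-- Between `A` and `A ⊕ B` a subspace splits as `A` plus its intersection with `B`, so vectors of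
`B` can be projected inside `B`. -/
theorem starProjection_eq_starProjection_comap (hAB : B ≤ Aᗮ) {K₀ : Submodule ℂ H}
    [CompleteSpace K₀] (hK₀ : K₀ ≤ A ⊔ B) (hA : A ≤ K₀) {L : Submodule ℂ B} [CompleteSpace L]
    (hL : L = K₀.comap B.subtype) (b : B) :
    K₀.starProjection (b : H) = (L.starProjection b : H) := by
  refine Submodule.eq_starProjection_of_mem_orthogonal ?_ ?_
  · have h : K₀.comap B.subtype = L := hL.symm
    exact h.ge (L.starProjection_apply_mem b)
  · rw [Submodule.mem_orthogonal]
    intro k hk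
    obtain ⟨a, ha, b₀, hb₀, rfl⟩ := Submodule.mem_sup.mp (hK₀ hk)
    have hb₀K : (⟨b₀, hb₀⟩ : B) ∈ L := by
      rw [hL]
      exact (Submodule.add_mem_iff_right _ (hA ha)).mp hk
    have h1 : ⟪a, ((b - L.starProjection b : B) : H)⟫_ℂ = 0 :=
      Submodule.inner_right_of_mem_orthogonal ha (hAB (b - L.starProjection b).2)
    have h2 : ⟪(⟨b₀, hb₀⟩ : B), b - L.starProjection b⟫_ℂ = 0 :=
      Submodule.inner_right_of_mem_orthogonal hb₀K (L.sub_starProjection_mem_orthogonal b)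
    rw [inner_add_left]
    change ⟪a, ((b - L.starProjection b : B) : H)⟫_ℂ +
      ⟪(⟨b₀, hb₀⟩ : B), b - L.starProjection b⟫_ℂ = 0
    rw [h1, h2, add_zero]

variable [CompleteSpace A] [CompleteSpace B]
  {T : H →ₗ.[ℂ] H} {TA : A →ₗ.[ℂ] A} {TB : B →ₗ.[ℂ] B} {G : B →L[ℂ] A}

theorem hasBlockForm_iff_graph : HasBlockForm T K A B TA TB G ↔
    ∀ x y : H, (x ∈ K ∧ (x, y) ∈ T.graph) ↔ ∃ (a a' : A) (b b' : B), (a, a') ∈ TA.graph ∧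
      (b, b') ∈ TB.graph ∧ x = (a : H) + b ∧
      y = ((a' + G b : A) : H) + ((ContinuousLinearMap.adjoint G a + b' : B) : H) := by
  refine forall₂_congr fun x y => iff_congr Iff.rfl ⟨?_, ?_⟩
  · rintro ⟨a, b, hx, hy⟩
    exact ⟨a, TA a, b, TB b, TA.mem_graph a, TB.mem_graph b, hx, hy⟩
  · rintro ⟨a, a', b, b', ha, hb, hx, hy⟩
    obtain ⟨a₀, rfl, rfl⟩ := (LinearPMap.mem_graph_iff TA).mp ha
    obtain ⟨b₀, rfl, rfl⟩ := (LinearPMap.mem_graph_iff TB).mp hb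
    exact ⟨a₀, b₀, hx, hy⟩

theorem HasBlockForm.swap (h : HasBlockForm T K A B TA TB G) :
    HasBlockForm T K B A TB TA (ContinuousLinearMap.adjoint G) := by
  intro x y
  rw [h x y, exists_comm]
  refine exists₂_congr fun b a => ?_
  rw [ContinuousLinearMap.adjoint_adjoint, add_comm (a : H), add_comm (TA a),
    add_comm (ContinuousLinearMap.adjoint G _), add_comm ((_ : A) : H)]

theorem HasBlockForm.mem_graph (h : HasBlockForm T K A B TA TB G) {a a' : A} {b b' : B}
    (ha : (a, a') ∈ TA.graph) (hb : (b, b') ∈ TB.graph) :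
    ((a : H) + b, ((a' + G b : A) : H) + ((ContinuousLinearMap.adjoint G a + b' : B) : H)) ∈
      T.graph :=
  ((hasBlockForm_iff_graph.mp h _ _).mpr ⟨a, a', b, b', ha, hb, rfl, rfl⟩).2

theorem HasBlockForm.exists_of_mem_graph (h : HasBlockForm T K A B TA TB G) {x y : H}
    (hx : x ∈ K) (hxy : (x, y) ∈ T.graph) : ∃ (a a' : A) (b b' : B), (a, a') ∈ TA.graph ∧
      (b, b') ∈ TB.graph ∧ x = (a : H) + b ∧
      y = ((a' + G b : A) : H) + ((ContinuousLinearMap.adjoint G a + b' : B) : H) :=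
  (hasBlockForm_iff_graph.mp h _ _).mp ⟨hx, hxy⟩

theorem HasBlockForm.mem_graph_left (h : HasBlockForm T K A B TA TB G) {a a' : A}
    (ha : (a, a') ∈ TA.graph) :
    ((a : H), (a' : H) + (ContinuousLinearMap.adjoint G a : H)) ∈ T.graph := by
  simpa using h.mem_graph ha (zero_mem TB.graph)

theorem HasBlockForm.mem_graph_right (h : HasBlockForm T K A B TA TB G) {b b' : B}
    (hb : (b, b') ∈ TB.graph) : ((b : H), (G b : H) + (b' : H)) ∈ T.graph := by
  simpa using h.mem_graph (zero_mem TA.graph) hb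

variable [CompleteSpace H] {hT : IsSelfAdjoint T}

/-- A reducing subspace that contains `A` contains the orbit of the range of the coupling to `A`. -/
theorem HasBlockForm.map_orbit_le (h : HasBlockForm T K A B TA TB G)
    (hTA : IsSelfAdjoint TA) (hTB : IsSelfAdjoint TB) (hAB : B ≤ Aᗮ)
    (hK : K = A ⊔ B) {K₀ : Submodule ℂ H} (hK₀ : Reduces (cayley T hT) K₀) (hK₀K : K₀ ≤ K)
    (hA : A ≤ K₀) :
    (orbit TB hTB (Set.range (ContinuousLinearMap.adjoint G))).map B.subtype ≤ K₀ := by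
  rw [Submodule.map_le_iff_le_comap]
  have : CompleteSpace K₀ := hK₀.isClosed.completeSpace_coe
  set L := K₀.comap B.subtype with hL
  have hLc : IsClosed (L : Set B) := hK₀.isClosed.preimage continuous_subtype_val
  have : CompleteSpace L := hLc.completeSpace_coe
  have hP := starProjection_eq_starProjection_comap hAB (hK ▸ hK₀K) hA hL
  -- Project the graph element `(b, G b + b')` of `T` to `K₀`: the first entry stays in `B` and `G
  -- b` is fixed. Reading the block form with zero `A`-component gives the projected pair in the
  -- graph of `TB`.
  have hr : Reduces (cayley TB hTB) L := by
    refine reduces_of_starProjection_mem_graph fun b b' hb => ?_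
    have h1 := hK₀.starProjection_mem_graph (h.mem_graph_right hb)
    rw [map_add, hP, hP, Submodule.starProjection_eq_self_iff.mpr (hA (G b).2)] at h1
    have hmem : ((L.starProjection b : B) : H) ∈ K := hK₀K (L.starProjection_apply_mem b)
    obtain ⟨a, a', c, c', ha, hc, hx, hy⟩ := h.exists_of_mem_graph hmem h1
    rw [← zero_add ((L.starProjection b : B) : H), ← Submodule.coe_zero (p := A),
      add_eq_add_iff_of_isOrtho hAB] at hx
    rw [add_eq_add_iff_of_isOrtho hAB] at hy
    rw [hx.2, hy.2, ← hx.1, map_zero, zero_add]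
    exact hc
  refine hr.orbit_le ?_
  rintro _ ⟨a, rfl⟩
  -- For `a` in the domain of `TA`, both `a` and `T a = TA a + G† a` lie in `K₀`, hence so does `G†
  -- a`; density and closedness extend this to all of `A`.
  have hcl : IsClosed {a : A | ContinuousLinearMap.adjoint G a ∈ L} :=
    hLc.preimage (ContinuousLinearMap.adjoint G).continuous
  refine hcl.closure_subset_iff.mpr (fun a ha => ?_) (hTA.dense_domain a)
  obtain ⟨a', ha'⟩ := LinearPMap.mem_domain_iff.mp ha
  exact (Submodule.add_mem_iff_right _ (hA a'.2)).mp
    (hK₀.mem_of_mem_graph (hA a.2) (h.mem_graph_left ha'))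

/-- Minimality of the triple says that the hidden space is the orbit of `Ran Γ'†`, and every
reducing subspace of `K` containing `A` contains that orbit. -/
theorem IsMinimalExtensionIn.eq_orbit {a : ℝ → A →L[ℂ] A} (hTA : IsSelfAdjoint TA)
    (h : IsMinimalExtensionIn T hT A TA a K) : K = orbit T hT A := by
  obtain ⟨hinv, H₂, _, T₂, hT₂, G₂, hAB, hK, hblock, hmin⟩ := h
  have hA : A ≤ K := hK ▸ le_sup_left
  have hle : orbit T hT A ≤ K := (isInvariant_iff_reduces.mp hinv).orbit_le hA
  refine le_antisymm ?_ hle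
  have h1 := hblock.map_orbit_le hTA hT₂ hAB hK (reduces_orbit (hT := hT) A) hle (subset_orbit _)
  rw [hmin.minimal, Submodule.map_top, Submodule.range_subtype] at h1
  conv_lhs => rw [hK]
  exact sup_le (subset_orbit _) h1

end Block

/-! ### Existence of the minimal extension -/

section Existence

variable {H : Type*} [NormedAddCommGroup H] [InnerProductSpace ℂ H]

/-- The isometric inclusion into `B` of a subspace `L` of `B`, seen as a subspace of `H`. -/
def mapSubtypeIsometry {B : Submodule ℂ H} (L : Submodule ℂ B) : L.map B.subtype →ₗᵢ[ℂ] B where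
  toLinearMap := Submodule.inclusion (Submodule.map_subtype_le B L)
  norm_map' _ := rfl

theorem range_mapSubtypeIsometry {B : Submodule ℂ H} (L : Submodule ℂ B) :
    LinearMap.range (mapSubtypeIsometry L).toLinearMap = L := by
  ext b
  constructor
  · rintro ⟨⟨_, c, hc, rfl⟩, rfl⟩
    exact hc
  · intro hb
    exact ⟨⟨b, b, hb, rfl⟩, rfl⟩

theorem exists_add_eq (A : Submodule ℂ H) [CompleteSpace A] (x : H) :
    ∃ (a : A) (b : Aᗮ), x = (a : H) + b :=
  ⟨A.orthogonalProjectionOnto x, Aᗮ.orthogonalProjectionOnto x,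
    (A.starProjection_add_starProjection_orthogonal x).symm⟩

variable {A B : Submodule ℂ H}

theorem orthogonalProjectionOnto_add [CompleteSpace B] (hAB : B ≤ Aᗮ) (a : A) (b : B) :
    B.orthogonalProjectionOnto ((a : H) + b) = b := by
  rw [map_add, Submodule.orthogonalProjectionOnto_mem_subspace_eq_self,
    Submodule.orthogonalProjectionOnto_apply_of_mem_orthogonal (Submodule.IsOrtho.symm hAB a.2),
    zero_add]

/-- As a preimage under a continuous map, the algebraic sum is visibly closed when `L` is. -/
theorem sup_map_subtype_eq_comap [CompleteSpace B] (hAB : B ≤ Aᗮ) (hsup : A ⊔ B = ⊤) (L : Submodule ℂ B) :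
    A ⊔ L.map B.subtype = L.comap B.orthogonalProjectionOnto.toLinearMap := by
  refine le_antisymm (sup_le (fun a ha => ?_) ?_) fun x hx => ?_
  · have := orthogonalProjectionOnto_add hAB ⟨a, ha⟩ 0
    rw [Submodule.coe_zero, add_zero] at this
    change B.orthogonalProjectionOnto a ∈ L
    rw [this]
    exact zero_mem L
  · rintro _ ⟨b, hb, rfl⟩
    change B.orthogonalProjectionOnto (b : H) ∈ L
    rwa [Submodule.orthogonalProjectionOnto_mem_subspace_eq_self]
  · obtain ⟨a, ha, b, hb, rfl⟩ := Submodule.mem_sup.mp (hsup ▸ Submodule.mem_top : x ∈ A ⊔ B)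
    have h1 := orthogonalProjectionOnto_add hAB ⟨a, ha⟩ ⟨b, hb⟩
    change B.orthogonalProjectionOnto (a + b) ∈ L at hx
    rw [h1] at hx
    exact Submodule.add_mem_sup ha ⟨_, hx, rfl⟩

theorem starProjection_sup_map_subtype (hAB : B ≤ Aᗮ) {L : Submodule ℂ B}
    [CompleteSpace L] {M : Submodule ℂ H} [CompleteSpace M] (hM : M = A ⊔ L.map B.subtype)
    (a : A) (b : B) :
    M.starProjection ((a : H) + b) = (a : H) + (L.starProjection b : B) := by
  have h1 := starProjection_eq_starProjection_comap hAB (K₀ := M) (L := L)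
    (hM.le.trans (sup_le_sup_left (Submodule.map_subtype_le B L) A)) (hM ▸ le_sup_left) ?_ b
  · rw [map_add, h1, Submodule.starProjection_eq_self_iff.mpr (hM ▸ Submodule.mem_sup_left a.2)]
  · ext c
    constructor
    · intro hc
      exact hM ▸ Submodule.mem_sup_right (Submodule.mem_map_of_mem hc)
    · intro hc
      obtain ⟨a, ha, _, ⟨d, hd, rfl⟩, h⟩ := Submodule.mem_sup.mp
        (hM.le hc : (c : H) ∈ A ⊔ L.map B.subtype)
      have h2 : (((⟨a, ha⟩ : A) : H)) + d = ((0 : A) : H) + c := by simpa using h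
      rw [add_eq_add_iff_of_isOrtho hAB] at h2
      exact h2.2 ▸ hd

variable [CompleteSpace A] [CompleteSpace B]
  {T : H →ₗ.[ℂ] H} {TA : A →ₗ.[ℂ] A} {TB : B →ₗ.[ℂ] B} {G : B →L[ℂ] A}

/-- `G` vanishes on the orthogonal complement of `L`, because `L` contains `Ran G†`. -/
theorem apply_starProjection_of_adjoint_mem {L : Submodule ℂ B} [CompleteSpace L]
    (hL : ∀ a, ContinuousLinearMap.adjoint G a ∈ L) (b : B) : G (L.starProjection b) = G b :=
  ext_inner_left ℂ fun a => by
    rw [← ContinuousLinearMap.adjoint_inner_left G, ← ContinuousLinearMap.adjoint_inner_left G,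
      ← Submodule.inner_starProjection_left_eq_right,
      Submodule.starProjection_eq_self_iff.mpr (hL a)]

theorem HasBlockForm.restrict (h : HasBlockForm T ⊤ A B TA TB G) (hAB : B ≤ Aᗮ)
    {L : Submodule ℂ B} [CompleteSpace (L.map B.subtype)]
    {hTB : IsSelfAdjoint TB} (hL : Reduces (cayley TB hTB) L)
    (hG : ∀ a, ContinuousLinearMap.adjoint G a ∈ L) :
    HasBlockForm T (A ⊔ L.map B.subtype) A (L.map B.subtype) TA
      (compress TB (mapSubtypeIsometry L))
      (G ∘L (mapSubtypeIsometry L).toContinuousLinearMap) := by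
  have : CompleteSpace L := hL.isClosed.completeSpace_coe
  set J := mapSubtypeIsometry L
  have hJ := isometry_adjoint_apply J (range_mapSubtypeIsometry L)
  have hJG : ∀ a, J (ContinuousLinearMap.adjoint (G ∘L J.toContinuousLinearMap) a) =
      ContinuousLinearMap.adjoint G a := fun a => by
    rw [ContinuousLinearMap.adjoint_comp, ContinuousLinearMap.comp_apply, hJ,
      Submodule.starProjection_eq_self_iff.mpr (hG a)]
  have hy : ∀ a a' c c', ((a' + (G ∘L J.toContinuousLinearMap) c : A) : H) +
      ((ContinuousLinearMap.adjoint (G ∘L J.toContinuousLinearMap) a + c' : L.map B.subtype) : H) =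
      ((a' + G (J c) : A) : H) + ((ContinuousLinearMap.adjoint G a + J c' : B) : H) :=
    fun a a' c c' => by
      rw [← hJG a, ← map_add]
      rfl
  rw [hasBlockForm_iff_graph]
  intro x y
  constructor
  · rintro ⟨hx, hxy⟩
    obtain ⟨a, a', b, b', ha, hb, rfl, rfl⟩ := h.exists_of_mem_graph Submodule.mem_top hxy
    obtain ⟨a₀, ha₀, _, ⟨c, hc, rfl⟩, hac⟩ := Submodule.mem_sup.mp hx
    have hac' : ((⟨a₀, ha₀⟩ : A) : H) + c = (a : H) + b := hac
    rw [add_eq_add_iff_of_isOrtho hAB] at hac'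
    have hbL : b ∈ L := hac'.2 ▸ hc
    have hbL' : b' ∈ L := hL.mem_of_mem_graph hbL hb
    refine ⟨a, a', ⟨b, b, hbL, rfl⟩, ⟨b', b', hbL', rfl⟩, ha, ?_, rfl, ?_⟩
    · exact (mem_graph_compress _ _ _ _).mpr hb
    · rw [hy]
      rfl
  · rintro ⟨a, a', c, c', ha, hc, rfl, rfl⟩
    refine ⟨Submodule.add_mem_sup a.2 c.2, ?_⟩
    rw [hy]
    exact h.mem_graph ha ((mem_graph_compress _ _ _ _).mp hc)

variable [CompleteSpace H] {hT : IsSelfAdjoint T} {hTA : IsSelfAdjoint TA}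
  {hTB : IsSelfAdjoint TB}

/-- The projection acts as the identity on `A` and as `P_L` on `B`. It commutes with the block
operator since `G P_L = G`, `P_L G† = G†` and `L` reduces `TB`. -/
theorem HasBlockForm.reduces_sup (h : HasBlockForm T ⊤ A B TA TB G) (hAB : B ≤ Aᗮ)
    (hsup : A ⊔ B = ⊤) {L : Submodule ℂ B} (hL : Reduces (cayley TB hTB) L)
    (hG : ∀ a, ContinuousLinearMap.adjoint G a ∈ L) :
    Reduces (cayley T hT) (A ⊔ L.map B.subtype) := by
  have : CompleteSpace L := hL.isClosed.completeSpace_coe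
  have hcl : IsClosed ((A ⊔ L.map B.subtype : Submodule ℂ H) : Set H) := by
    rw [sup_map_subtype_eq_comap hAB hsup]
    exact hL.isClosed.preimage B.orthogonalProjectionOnto.continuous
  have : CompleteSpace (A ⊔ L.map B.subtype : Submodule ℂ H) := hcl.completeSpace_coe
  refine reduces_of_starProjection_mem_graph fun x y hxy => ?_
  obtain ⟨a, a', b, b', ha, hb, rfl, rfl⟩ := h.exists_of_mem_graph Submodule.mem_top hxy
  rw [starProjection_sup_map_subtype hAB rfl, starProjection_sup_map_subtype hAB rfl, map_add,
    Submodule.starProjection_eq_self_iff.mpr (hG a),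
    ← apply_starProjection_of_adjoint_mem hG b]
  exact h.mem_graph ha (hL.starProjection_mem_graph hb)

theorem HasBlockForm.orbit_eq_sup (h : HasBlockForm T ⊤ A B TA TB G) (hTA : IsSelfAdjoint TA)
    (hAB : B ≤ Aᗮ) (hsup : A ⊔ B = ⊤) : orbit T hT A =
      A ⊔ (orbit TB hTB (Set.range (ContinuousLinearMap.adjoint G))).map B.subtype :=
  le_antisymm
    ((h.reduces_sup hAB hsup (reduces_orbit _) fun a =>
      subset_orbit (Set.range (ContinuousLinearMap.adjoint G)) ⟨a, rfl⟩).orbit_le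
      fun _ ha => Submodule.mem_sup_left ha)
    (sup_le (subset_orbit _)
      (h.map_orbit_le hTA hTB hAB hsup.symm (reduces_orbit _) le_top (subset_orbit _)))

theorem HasBlockForm.isMinimalExtensionIn_orbit (h : HasBlockForm T ⊤ A B TA TB G)
    (hTA : IsSelfAdjoint TA) (hAB : B ≤ Aᗮ) (hsup : A ⊔ B = ⊤) :
    IsMinimalExtensionIn T hT A TA (frictionFunction TB hTB G) (orbit T hT A) := by
  set L := orbit TB hTB (Set.range (ContinuousLinearMap.adjoint G)) with hLdef
  have hL : Reduces (cayley TB hTB) L := reduces_orbit _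
  have hG : ∀ a, ContinuousLinearMap.adjoint G a ∈ L := fun a => subset_orbit _ ⟨a, rfl⟩
  have : CompleteSpace L := hL.isClosed.completeSpace_coe
  have hcl : IsClosed ((L.map B.subtype : Submodule ℂ H) : Set H) :=
    ((completeSpace_coe_iff_isComplete.mp
      ‹CompleteSpace B›).isClosed.isClosedEmbedding_subtypeVal.isClosedMap) _ hL.isClosed
  have hc : CompleteSpace (L.map B.subtype) := hcl.completeSpace_coe
  set J := mapSubtypeIsometry L with hJdef
  have hJ := isometry_adjoint_apply J (range_mapSubtypeIsometry L)
  have hsa : IsSelfAdjoint (compress TB J) := isSelfAdjoint_compress hTB fun x y hxy => by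
    rw [hJ, hJ]
    exact hL.starProjection_mem_graph hxy
  have hint := intertwines_cayley hTB hsa (J := J.toContinuousLinearMap)
    fun x y hxy => (mem_graph_compress TB J x y).mp hxy
  have hid : ContinuousLinearMap.adjoint J.toContinuousLinearMap ∘L J.toContinuousLinearMap =
      .id ℂ _ := ContinuousLinearMap.ext (adjoint_isometry_apply J)
  refine ⟨isInvariant_iff_reduces.mpr (reduces_orbit _), L.map B.subtype, hc, compress TB J, hsa,
    G ∘L J.toContinuousLinearMap, (Submodule.map_subtype_le B L).trans hAB,
    h.orbit_eq_sup hTA hAB hsup, ?_, ?_, ?_⟩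
  · rw [h.orbit_eq_sup (hTB := hTB) hTA hAB hsup]
    exact h.restrict hAB hL hG
  -- The new friction function is `G J J† exp(-i t TB) J J† G†`, and the projection `J J†` onto `L`
  -- is absorbed by `G` and by `G†`.
  · intro t _
    ext a : 1
    rw [frictionFunction, frictionFunction, ← evolution_compression hTB hsa hid hint,
      ContinuousLinearMap.adjoint_comp]
    simp only [ContinuousLinearMap.comp_apply, LinearIsometry.coe_toContinuousLinearMap, hJ]
    rw [Submodule.starProjection_eq_self_iff.mpr (hG a),
      apply_starProjection_of_adjoint_mem hG]
  · set W := orbit (compress TB J) hsa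
      (Set.range (ContinuousLinearMap.adjoint (G ∘L J.toContinuousLinearMap)))
    -- The image of the compressed orbit reduces `TB` and contains `Ran G†`, hence contains `L`; so
    -- nothing of `L` is missed.
    have hW : Reduces (cayley TB hTB) (W.map J.toLinearMap) :=
      Reduces.map_isometry hint (reduces_orbit _)
    have hLW : L ≤ W.map J.toLinearMap := by
      refine hW.orbit_le ?_
      rintro _ ⟨a, rfl⟩
      refine ⟨_, subset_orbit _ ⟨a, rfl⟩, ?_⟩
      change J _ = _
      rw [ContinuousLinearMap.adjoint_comp, ContinuousLinearMap.comp_apply, hJ,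
        Submodule.starProjection_eq_self_iff.mpr (hG a)]
    rw [eq_top_iff]
    intro x _
    have hx : J x ∈ L := (range_mapSubtypeIsometry L).le ⟨x, rfl⟩
    obtain ⟨w, hw, hwx⟩ := hLW hx
    exact J.injective hwx ▸ hw

theorem HasBlockForm.isMinimalExtensionIn_top_iff (h : HasBlockForm T ⊤ A B TA TB G)
    (hTA : IsSelfAdjoint TA) (hAB : B ≤ Aᗮ) (hsup : A ⊔ B = ⊤) :
    IsMinimalExtensionIn T hT A TA (frictionFunction TB hTB G) ⊤ ↔ orbit T hT A = ⊤ :=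
  ⟨fun h' => (h'.eq_orbit hTA).symm,
    fun h' => h' ▸ h.isMinimalExtensionIn_orbit hTA hAB hsup⟩

end Existence

/-! ### The coupling operator -/

section Coupling

variable {H : Type*} [NormedAddCommGroup H] [InnerProductSpace ℂ H] [CompleteSpace H]
  {A : Submodule ℂ H} [CompleteSpace A]
  {T : H →ₗ.[ℂ] H} {TA : A →ₗ.[ℂ] A} {TB : Aᗮ →ₗ.[ℂ] Aᗮ} {G : Aᗮ →L[ℂ] A}

theorem couplingOperator_apply (G : Aᗮ →L[ℂ] A) (x : H) : couplingOperator A G x =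
    (G (Aᗮ.orthogonalProjectionOnto x) : H) +
      (ContinuousLinearMap.adjoint G (A.orthogonalProjectionOnto x) : H) := rfl

theorem couplingOperator_add (G : Aᗮ →L[ℂ] A) (a : A) (b : Aᗮ) :
    couplingOperator A G ((a : H) + b) = (G b : H) + (ContinuousLinearMap.adjoint G a : H) := by
  rw [couplingOperator_apply, orthogonalProjectionOnto_add le_rfl, add_comm (a : H),
    orthogonalProjectionOnto_add A.le_orthogonal_orthogonal]

theorem couplingOperator_add_eq_zero_iff (G : Aᗮ →L[ℂ] A) (a : A) (b : Aᗮ) :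
    couplingOperator A G ((a : H) + b) = 0 ↔ G b = 0 ∧ ContinuousLinearMap.adjoint G a = 0 := by
  rw [couplingOperator_add, ← add_eq_add_iff_of_isOrtho (le_refl Aᗮ)]
  simp

theorem inner_couplingOperator (G : Aᗮ →L[ℂ] A) (x y : H) :
    ⟪couplingOperator A G x, y⟫_ℂ = ⟪x, couplingOperator A G y⟫_ℂ := by
  obtain ⟨a, b, rfl⟩ := exists_add_eq A x
  obtain ⟨c, d, rfl⟩ := exists_add_eq A y
  have h : ∀ (a : A) (b : Aᗮ), ⟪(a : H), (b : H)⟫_ℂ = 0 ∧ ⟪(b : H), (a : H)⟫_ℂ = 0 := fun a b =>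
    ⟨Submodule.inner_right_of_mem_orthogonal a.2 b.2,
      Submodule.inner_left_of_mem_orthogonal a.2 b.2⟩
  rw [couplingOperator_add, couplingOperator_add]
  simp only [inner_add_left, inner_add_right, (h _ _).1, (h _ _).2, ← Submodule.coe_inner,
    ContinuousLinearMap.adjoint_inner_left, ContinuousLinearMap.adjoint_inner_right]
  ring

theorem mem_orthogonal_range_couplingOperator {G : Aᗮ →L[ℂ] A} {φ : H} :
    φ ∈ (couplingOperator A G).rangeᗮ ↔ couplingOperator A G φ = 0 := by
  rw [Submodule.mem_orthogonal]
  constructor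
  · intro h
    refine ext_inner_left ℂ fun x => ?_
    rw [← inner_couplingOperator, inner_zero_right]
    exact h _ ⟨x, rfl⟩
  · rintro h _ ⟨x, rfl⟩
    change ⟪couplingOperator A G x, φ⟫_ℂ = 0
    rw [inner_couplingOperator, h, inner_zero_right]

/-- On a vector annihilated by the coupling, `T` acts diagonally, so it commutes with the projection
to `A` there. -/
theorem HasBlockForm.starProjection_mem_graph (h : HasBlockForm T ⊤ A Aᗮ TA TB G) {x y : H}
    (hxy : (x, y) ∈ T.graph) (hx : couplingOperator A G x = 0) :
    (A.starProjection x, A.starProjection y) ∈ T.graph := by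
  obtain ⟨a, a', b, b', ha, hb, rfl, rfl⟩ := h.exists_of_mem_graph Submodule.mem_top hxy
  obtain ⟨hb0, ha0⟩ := (couplingOperator_add_eq_zero_iff G a b).mp hx
  have hP : ∀ (a : A) (b : Aᗮ), A.starProjection ((a : H) + b) = a := fun a b => by
    rw [Submodule.starProjection_apply, add_comm,
      orthogonalProjectionOnto_add A.le_orthogonal_orthogonal]
  rw [hP, hP, hb0, add_zero]
  simpa [ha0] using h.mem_graph_left ha

variable {hT : IsSelfAdjoint T}

/-- The projection to `A` of a reducing subspace that the coupling annihilates has a reducing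
closure. -/
theorem HasBlockForm.reduces_closure_map_starProjection (h : HasBlockForm T ⊤ A Aᗮ TA TB G)
    {M : Submodule ℂ H} (hM : Reduces (cayley T hT) M)
    (hMG : ∀ x ∈ M, couplingOperator A G x = 0) :
    Reduces (cayley T hT) (M.map A.starProjection.toLinearMap).topologicalClosure := by
  have : CompleteSpace M := hM.isClosed.completeSpace_coe
  have hU : ∀ m ∈ M, (cayley T hT : H →L[ℂ] H) (A.starProjection m) =
      A.starProjection ((cayley T hT : H →L[ℂ] H) m) := by
    intro m hm
    obtain ⟨x, y, hxy, rfl⟩ := surjective_add_smul hT Complex.I (Or.inl rfl) m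
    -- Replacing `(x, y)` by its projection to `M` leaves `m = y + i x` unchanged and puts the first
    -- entry in `M`, where the coupling vanishes.
    have h1 := hM.starProjection_mem_graph hxy
    have h2 : M.starProjection y + Complex.I • M.starProjection x = y + Complex.I • x := by
      rw [← map_smul, ← map_add, Submodule.starProjection_eq_self_iff.mpr hm]
    have h3 := h.starProjection_mem_graph h1 (hMG _ (M.starProjection_apply_mem x))
    rw [← h2, cayley_spec T hT h1, map_add, map_sub, map_smul, cayley_spec T hT h3]
  refine reduces_topologicalClosure ?_ ?_
  · rintro _ ⟨m, hm, rfl⟩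
    exact Submodule.le_topologicalClosure _ ⟨_, hM.apply_mem m hm, (hU m hm).symm⟩
  · rintro _ ⟨m, hm, rfl⟩
    refine Submodule.le_topologicalClosure _ ⟨_, hM.star_apply_mem m hm, ?_⟩
    have h1 := hU _ (hM.star_apply_mem m hm)
    rw [unitary_apply_star_apply] at h1
    change A.starProjection _ = star (cayley T hT : H →L[ℂ] H) (A.starProjection m)
    rw [← h1, unitary_star_apply_apply]

/-- The gap `K ⊓ Nᗮ` between the orbits is reducing and annihilated by the coupling. Its projection
to `A` would generate an invariant subspace of `A`, so the gap is orthogonal to `A`, hence to `K`,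
which contains it. -/
theorem HasBlockForm.orbit_range_couplingOperator (h : HasBlockForm T ⊤ A Aᗮ TA TB G)
    (hTA : IsSelfAdjoint TA) (hTB : IsSelfAdjoint TB) (hA : HasNoInvariantSubspace T hT A) :
    orbit T hT A = orbit T hT (couplingOperator A G).range := by
  have hK := reduces_orbit (T := T) (hT := hT) A
  have hN := reduces_orbit (T := T) (hT := hT) (couplingOperator A G).range
  set K := orbit T hT A
  set N := orbit T hT (couplingOperator A G).range
  have : CompleteSpace N := hN.isClosed.completeSpace_coe
  have hNK : N ≤ K := by
    refine hK.orbit_le ?_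
    rintro _ ⟨x, rfl⟩
    change couplingOperator A G x ∈ K
    rw [couplingOperator_apply]
    refine add_mem (subset_orbit _ (G _).2) ?_
    exact h.map_orbit_le hTA hTB le_rfl A.sup_orthogonal_of_hasOrthogonalProjection.symm hK le_top
      (subset_orbit _) ⟨_, subset_orbit _ ⟨_, rfl⟩, rfl⟩
  have hM := hK.inf hN.orthogonal
  have hMG : ∀ x ∈ K ⊓ Nᗮ, couplingOperator A G x = 0 := fun x hx =>
    mem_orthogonal_range_couplingOperator.mp (Submodule.orthogonal_le (subset_orbit _) hx.2)
  have hQ := h.reduces_closure_map_starProjection hM hMG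
  have hQA : ((K ⊓ Nᗮ).map A.starProjection.toLinearMap).topologicalClosure ≤ A := by
    refine Submodule.topologicalClosure_minimal _ ?_
      (completeSpace_coe_iff_isComplete.mp ‹CompleteSpace A›).isClosed
    rintro _ ⟨m, -, rfl⟩
    exact A.starProjection_apply_mem m
  have hQ0 := hA _ hQA (isInvariant_iff_reduces.mpr hQ)
  have hMA : K ⊓ Nᗮ ≤ Aᗮ := fun m hm => by
    rw [← A.starProjection_apply_eq_zero_iff, ← Submodule.mem_bot ℂ, ← hQ0]
    exact Submodule.le_topologicalClosure _ ⟨m, hm, rfl⟩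
  have hMK := le_orthogonal_orbit hM hMA
  refine le_antisymm (fun k hk => ?_) hNK
  have hd : k - N.starProjection k ∈ K ⊓ Nᗮ :=
    ⟨sub_mem hk (hNK (N.starProjection_apply_mem k)), N.sub_starProjection_mem_orthogonal k⟩
  have h0 : k - N.starProjection k = 0 :=
    Submodule.disjoint_def.mp (Submodule.orthogonal_disjoint K) _ hd.1 (hMK hd)
  exact Submodule.starProjection_eq_self_iff.mp (sub_eq_zero.mp h0).symm

/-- The coupling annihilates some eigenmode if and only if one of the two summands contains an
eigenmode. -/
theorem HasBlockForm.forall_eigenmode_couplingOperator_ne_zero_iff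
    (h : HasBlockForm T ⊤ A Aᗮ TA TB G) :
    (∀ φ, IsEigenmode T φ → couplingOperator A G φ ≠ 0) ↔
      (∀ φ, IsEigenmode T φ → φ ∉ Aᗮ) ∧ ∀ φ, IsEigenmode T φ → φ ∉ Aᗮᗮ := by
  constructor
  · intro hC
    -- If `a = 0`, the `A`-component of the eigenvalue equation reads `0 = G b`, so the coupling
    -- annihilates `φ`; likewise if `b = 0`.
    have key : ∀ φ, IsEigenmode T φ → ∀ a : A, ∀ b : Aᗮ, φ = (a : H) + b → a ≠ 0 ∧ b ≠ 0 := by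
      rintro φ ⟨h0, z, hz⟩ a b rfl
      have hne := hC _ ⟨h0, z, hz⟩
      obtain ⟨c, c', d, d', hc, hd, hx, hy⟩ := h.exists_of_mem_graph Submodule.mem_top hz
      rw [LinearMap.id_apply, add_eq_add_iff_of_isOrtho le_rfl] at hx
      obtain ⟨rfl, rfl⟩ := hx
      have hy' : ((z • a : A) : H) + ((z • b : Aᗮ) : H) =
          ((c' + G b : A) : H) + ((ContinuousLinearMap.adjoint G a + d' : Aᗮ) : H) := by
        rw [← hy]
        simp
      rw [add_eq_add_iff_of_isOrtho le_rfl] at hy'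
      constructor
      · rintro rfl
        refine hne ((couplingOperator_add_eq_zero_iff G _ _).mpr ⟨?_, map_zero _⟩)
        simpa [TA.graph_fst_eq_zero_snd hc rfl] using hy'.1.symm
      · rintro rfl
        refine hne ((couplingOperator_add_eq_zero_iff G _ _).mpr ⟨map_zero _, ?_⟩)
        simpa [TB.graph_fst_eq_zero_snd hd rfl] using hy'.2.symm
    refine ⟨fun φ hφ hA => (key φ hφ 0 ⟨φ, hA⟩ (by simp)).1 rfl, fun φ hφ hA => ?_⟩
    rw [Submodule.orthogonal_orthogonal] at hA
    exact (key φ hφ ⟨φ, hA⟩ 0 (by simp)).2 rfl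
  · rintro ⟨h1, h2⟩ φ ⟨h0, z, hz⟩ hC
    have hA : A.starProjection φ ∈ eigenspace T z := by
      have := h.starProjection_mem_graph hz hC
      rwa [LinearMap.smul_apply, map_smul] at this
    have hB : φ - A.starProjection φ ∈ eigenspace T z := sub_mem hz hA
    by_cases hA0 : A.starProjection φ = 0
    · exact h1 φ ⟨h0, z, hz⟩ (A.starProjection_apply_eq_zero_iff.mp hA0)
    · exact h2 _ ⟨hA0, z, hA⟩ (A.le_orthogonal_orthogonal (A.starProjection_apply_mem φ))

end Coupling

end OpenSystems

/-! ### The main theorem -/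

theorem mainTheorem5 {H : Type*} [NormedAddCommGroup H] [InnerProductSpace ℂ H] [CompleteSpace H]
    [TopologicalSpace.SeparableSpace H]
    (Ω : H →ₗ.[ℂ] H) (hΩ : IsSelfAdjoint Ω)
    (H₁ : Submodule ℂ H) [CompleteSpace H₁]
    (Ω₁ : H₁ →ₗ.[ℂ] H₁) (hΩ₁ : IsSelfAdjoint Ω₁)
    (Ω₂ : H₁ᗮ →ₗ.[ℂ] H₁ᗮ) (hΩ₂ : IsSelfAdjoint Ω₂)
    (Γ : H₁ᗮ →L[ℂ] H₁)
    (hblock : HasBlockForm Ω ⊤ H₁ H₁ᗮ Ω₁ Ω₂ Γ) :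
    (∃! K, IsMinimalExtensionIn Ω hΩ H₁ Ω₁ (frictionFunction Ω₂ hΩ₂ Γ) K) ∧
    ∀ Hmin, IsMinimalExtensionIn Ω hΩ H₁ Ω₁ (frictionFunction Ω₂ hΩ₂ Γ) Hmin →
      Hmin = orbit Ω hΩ H₁ ∧
      (HasNoInvariantSubspace Ω hΩ H₁ → Hmin = orbit Ω hΩ (couplingOperator H₁ Γ).range) ∧
      -- pure point spectrum: sums over eigenspaces
      (HasPurePointSpectrum Ω →
        (eigenvalues Ω).Countable ∧
        IsClosedOrthogonalSum Hmin
          (fun z : eigenvalues Ω => projectedEigenspace Ω hΩ H₁ z) ∧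
        (HasNoInvariantSubspace Ω hΩ H₁ →
          IsClosedOrthogonalSum Hmin
            (fun z : eigenvalues Ω =>
              projectedEigenspace Ω hΩ (couplingOperator H₁ Γ).range z))) ∧
      -- general spectrum: spans of spectral projections over intervals
      (Hmin = spectralSpan Ω hΩ intervals H₁ ∧
        ∀ ε : ℝ, 0 < ε → Hmin = spectralSpan Ω hΩ (intervalsOfLength ε) H₁) ∧
      (HasNoInvariantSubspace Ω hΩ H₁ →
        Hmin = spectralSpan Ω hΩ intervals (couplingOperator H₁ Γ).range ∧
        ∀ ε : ℝ, 0 < ε →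
          Hmin = spectralSpan Ω hΩ (intervalsOfLength ε) (couplingOperator H₁ Γ).range) ∧
      -- pure point spectrum: criteria in terms of eigenmodes
      (HasPurePointSpectrum Ω →
        (Hmin = ⊤ ↔ ∀ φ, IsEigenmode Ω φ → H₁.starProjection φ ≠ 0) ∧
        (HasNoInvariantSubspace Ω hΩ H₁ →
          (Hmin = ⊤ ↔ ∀ φ, IsEigenmode Ω φ → couplingOperator H₁ Γ φ ≠ 0)) ∧
        (IsReconstructible Ω hΩ H₁ Ω₁ hΩ₁ Ω₂ hΩ₂ Γ ↔
          ∀ φ, IsEigenmode Ω φ → couplingOperator H₁ Γ φ ≠ 0)) := by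
  have hsup : H₁ ⊔ H₁ᗮ = ⊤ := H₁.sup_orthogonal_of_hasOrthogonalProjection
  have hsup' : H₁ᗮ ⊔ H₁ = ⊤ := sup_comm H₁ H₁ᗮ ▸ hsup
  have hmin := hblock.isMinimalExtensionIn_orbit (hT := hΩ) (hTB := hΩ₂) hΩ₁ le_rfl hsup
  have hcoupling := hblock.orbit_range_couplingOperator (hT := hΩ) hΩ₁ hΩ₂
  have hcriterion : HasPurePointSpectrum Ω →
      (orbit Ω hΩ (couplingOperator H₁ Γ).range = ⊤ ↔
        ∀ φ, IsEigenmode Ω φ → couplingOperator H₁ Γ φ ≠ 0) := fun hpp => by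
    simp only [orbit_eq_top_iff hpp, mem_orthogonal_range_couplingOperator, ne_eq]
  refine ⟨⟨_, hmin, fun K hK => hK.eq_orbit hΩ₁⟩, fun Hmin hHmin => ?_⟩
  obtain rfl := hHmin.eq_orbit hΩ₁
  refine ⟨rfl, hcoupling, fun hpp => ⟨countable_eigenvalues hΩ, isClosedOrthogonalSum_orbit hpp H₁,
    fun hni => ?_⟩, ⟨orbit_eq_spectralSpan_intervals _,
    fun ε hε => orbit_eq_spectralSpan_intervalsOfLength hε _⟩, fun hni => ?_,
    fun hpp => ⟨?_, fun hni => ?_, ?_⟩⟩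
  · rw [hcoupling hni]
    exact isClosedOrthogonalSum_orbit hpp _
  · rw [hcoupling hni]
    exact ⟨orbit_eq_spectralSpan_intervals _,
      fun ε hε => orbit_eq_spectralSpan_intervalsOfLength hε _⟩
  · simp only [orbit_eq_top_iff hpp, ne_eq, H₁.starProjection_apply_eq_zero_iff]
  · rw [hcoupling hni, hcriterion hpp]
  -- The second open system is the first one with the summands exchanged. Both orbits are everything
  -- exactly when neither `H₁ᗮ` nor `H₁ᗮᗮ` contains an eigenmode.
  · rw [IsReconstructible, hblock.isMinimalExtensionIn_top_iff hΩ₁ le_rfl hsup,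
      hblock.swap.isMinimalExtensionIn_top_iff hΩ₂ H₁.le_orthogonal_orthogonal hsup',
      orbit_eq_top_iff hpp, orbit_eq_top_iff hpp,
      hblock.forall_eigenmode_couplingOperator_ne_zero_iff]
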